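/- Let $n,m\ge 0$ be integers, let $f:\mathbb{R}^n\to\mathbb{R}$ be strictly concave and $g=(g_1,\dots,g_m):\mathbb{R}^n\to\mathbb{R}^m$ have convex components, both continuously differentiable with locally Lipschitz gradients $\nabla f,\nabla g_1,\dots,\nabla g_m$. Consider the problem of maximizing $f(x)$ subject to $g(x)\le 0$ (componentwise). Assume that Slater's condition holds, i.e. there is $x\in\mathbb{R}^n$ with $g_i(x)<0$ for all $i$, and that the problem has an optimizer, i.e. a feasible point at which $f$ attains its maximum over the feasible set. Let $L(x,\lambda)=f(x)-\lambda^\top g(x)$. A pair $(x_*,\lambda_*)\in\mathbb{R}^n\times\mathbb{R}^m_{\ge 0}$ is called a primal-dual optimizer if $x_*$ is an optimizer of the problem and $\lambda_*$ minimizes $q(\lambda)=\sup_{x\in\mathbb{R}^n}L(x,\lambda)\in(-\infty,+\infty]$ over $\lambda\in\mathbb{R}^m_{\ge0}$. For $a\in\mathbb{R}$ and $b\ge 0$ put $[a]_b^+=a$ if $b>0$ and $[a]_b^+=\max\{0,a\}$ if $b=0$. The primal-dual dynamics on $\mathbb{R}^n\times\mathbb{R}^m_{\ge0}$ is $$\dot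 x=\nabla f(x)-\sum_{i=1}^m\lambda_i\nabla g_i(x),\qquad \dot\lambda_i=[g_i(x)]_{\lambda_i}^+\quad(i=1,\dots,m).$$ A (Carathéodory) solution on $[0,T)$, $0<T\le\infty$, is a curve $\gamma:[0,T)\to\mathbb{R}^n\times\mathbb{R}^m_{\ge0}$ that is absolutely continuous on compact subintervals of $[0,T)$ and satisfies these equations almost everywhere on $[0,T)$. Then the set $S$ of primal-dual optimizers coincides with the set of saddle points of $L$ on $\mathbb{R}^n\times\mathbb{R}^m_{\ge0}$, i.e. of the $(x_*,\lambda_*)\in\mathbb{R}^n\times\mathbb{R}^m_{\ge0}$ with $L(x,\lambda_*)\le L(x_*,\lambda_*)\le L(x_*,\lambda)$ for all $x\in\mathbb{R}^n$, $\lambda\in\mathbb{R}^m_{\ge0}$, and $S$ is globally asymptotically stable on $\mathbb{R}^n\times\mathbb{R}^m_{\ge 0}$ under the primal-dual dynamics, that is: 1. from every point of $\mathbb{R}^n\times\mathbb{R}^m_{\ge0}$ there starts a solution on $[0,\infty)$, and every solution on an interval $[0,T)$ is the restriction of a solution on $[0,\infty)$; 2. for every $\varepsilon>0$ there is $\delta>0$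 such that every solution with initial point at Euclidean distance less than $\delta$ from $S$ stays at distance less than $\varepsilon$ from $S$ as long as it is defined; 3. the distance to $S$ tends to $0$ as $t\to\infty$ along every solution on $[0,\infty)$. Moreover, every solution on $[0,\infty)$ converges, as $t\to\infty$, to a single point of $S$. -/

import Mathlib

open Set Filter Topology MeasureTheory

noncomputable section

namespace PrimalDual

/-! ### Carathéodory solutions and stability of sets -/

section Dynamics

variable {E : Type*} [NormedAddCommGroup E] [NormedSpace ℝ E]

/-- `γ` is a Carathéodory solution on `[0, T)`, `0 < T ≤ ∞`, of `γ' = X(γ)`, where the vector field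
is defined on the domain `K`: the curve takes its values in `K`, it is absolutely continuous
on every compact subinterval `[0, b]` of `[0, T)`, and it satisfies the differential equation
almost everywhere on `[0, T)`. Values of `X` outside `K`, and of `γ` outside `[0, T)`,
play no role. -/
structure IsCaratheodorySolution (K : Set E) (X : E → E) (T : EReal) (γ : ℝ → E) : Prop where
  pos : 0 < T
  mem : ∀ t : ℝ, 0 ≤ t → (t : EReal) < T → γ t ∈ K
  absCont : ∀ b : ℝ, 0 ≤ b → (b : EReal) < T → AbsolutelyContinuousOnInterval γ 0 b
  ode : ∀ᵐ t : ℝ, 0 ≤ t → (t : EReal) < T → HasDerivAt γ (X (γ t)) t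

/-- The set `S` is globally asymptotically stable on `K` under `γ' = X(γ)`: solutions exist for all
times from every initial point of `K`, every solution can be continued for all times,
`S` is Lyapunov stable, and every solution approaches `S`. -/
structure IsGloballyAsymptoticallyStableOn (K : Set E) (X : E → E) (S : Set E) : Prop where
  subset : S ⊆ K
  exists_solution : ∀ z ∈ K, ∃ γ : ℝ → E, IsCaratheodorySolution K X ⊤ γ ∧ γ 0 = z
  extends_solution : ∀ (T : EReal) (γ : ℝ → E), IsCaratheodorySolution K X T γ →
    ∃ γ' : ℝ → E, IsCaratheodorySolution K X ⊤ γ' ∧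
      ∀ t : ℝ, 0 ≤ t → (t : EReal) < T → γ' t = γ t
  stable : ∀ ε > 0, ∃ δ > 0, ∀ (T : EReal) (γ : ℝ → E), IsCaratheodorySolution K X T γ →
    γ 0 ∈ Metric.thickening δ S →
      ∀ t : ℝ, 0 ≤ t → (t : EReal) < T → γ t ∈ Metric.thickening ε S
  attractive : ∀ γ : ℝ → E, IsCaratheodorySolution K X ⊤ γ →
    ∀ ε > 0, ∀ᶠ t in atTop, γ t ∈ Metric.thickening ε S

end Dynamics

/-! ### The optimization problem `max f(x)` subject to `g(x) ≤ 0` -/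

section Problem

variable {n m : ℕ}

/-- The space `ℝⁿ × ℝᵐ` with the 2-norm. -/
abbrev State (n m : ℕ) : Type :=
  WithLp 2 (EuclideanSpace ℝ (Fin n) × EuclideanSpace ℝ (Fin m))

/-- The Lagrangian `L(x, λ) = f(x) - λᵀ g(x)`. -/
def lagrangian (f : EuclideanSpace ℝ (Fin n) → ℝ)
    (g : EuclideanSpace ℝ (Fin n) → EuclideanSpace ℝ (Fin m))
    (x : EuclideanSpace ℝ (Fin n)) (lam : EuclideanSpace ℝ (Fin m)) : ℝ :=
  f x - ∑ i, lam i * g x i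

/-- `x` solves the primal problem: it is feasible and maximizes `f` among the feasible points. -/
def IsPrimalOptimizer (f : EuclideanSpace ℝ (Fin n) → ℝ)
    (g : EuclideanSpace ℝ (Fin n) → EuclideanSpace ℝ (Fin m))
    (x : EuclideanSpace ℝ (Fin n)) : Prop :=
  (∀ i, g x i ≤ 0) ∧ ∀ y, (∀ i, g y i ≤ 0) → f y ≤ f x

/-- The dual function `q(λ) = sup_x L(x, λ)`, possibly `+∞`. -/
def dualFunction (f : EuclideanSpace ℝ (Fin n) → ℝ)
    (g : EuclideanSpace ℝ (Fin n) → EuclideanSpace ℝ (Fin m))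
    (lam : EuclideanSpace ℝ (Fin m)) : EReal :=
  ⨆ x : EuclideanSpace ℝ (Fin n), (lagrangian f g x lam : EReal)

/-- `λ` solves the dual problem: it minimizes the dual function over `λ ≥ 0`. -/
def IsDualOptimizer (f : EuclideanSpace ℝ (Fin n) → ℝ)
    (g : EuclideanSpace ℝ (Fin n) → EuclideanSpace ℝ (Fin m))
    (lam : EuclideanSpace ℝ (Fin m)) : Prop :=
  (∀ i, 0 ≤ lam i) ∧ ∀ mu : EuclideanSpace ℝ (Fin m), (∀ i, 0 ≤ mu i) →
    dualFunction f g lam ≤ dualFunction f g mu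

/-- The set of primal-dual optimizers. -/
def primalDualOptimizers (f : EuclideanSpace ℝ (Fin n) → ℝ)
    (g : EuclideanSpace ℝ (Fin n) → EuclideanSpace ℝ (Fin m)) : Set (State n m) :=
  {z | IsPrimalOptimizer f g z.fst ∧ IsDualOptimizer f g z.snd}

variable (n m) in
/-- The domain `ℝⁿ × ℝᵐ_{≥0}`. -/
def domain : Set (State n m) := {z | ∀ i, 0 ≤ z.snd i}

/-- The set of saddle points of the Lagrangian over `ℝⁿ × ℝᵐ_{≥0}`. -/
def saddlePoints (f : EuclideanSpace ℝ (Fin n) → ℝ)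
    (g : EuclideanSpace ℝ (Fin n) → EuclideanSpace ℝ (Fin m)) : Set (State n m) :=
  {z | z ∈ domain n m ∧
    (∀ x, lagrangian f g x z.snd ≤ lagrangian f g z.fst z.snd) ∧
    ∀ lam : EuclideanSpace ℝ (Fin m), (∀ i, 0 ≤ lam i) →
      lagrangian f g z.fst z.snd ≤ lagrangian f g z.fst lam}

/-- The operator `[a]_b^+`, used for `b ≥ 0` only: it is `a` if `b > 0` and `max {0, a}`
if `b = 0`. -/
def plusProj (a b : ℝ) : ℝ := if 0 < b then a else max 0 a

/-- The primal-dual dynamics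
`x' = ∇f(x) - ∑ᵢ λᵢ ∇gᵢ(x)`, `λ' = [g(x)]_λ^+`, considered on `ℝⁿ × ℝᵐ_{≥0}`. -/
def primalDualField (f : EuclideanSpace ℝ (Fin n) → ℝ)
    (g : EuclideanSpace ℝ (Fin n) → EuclideanSpace ℝ (Fin m)) (z : State n m) : State n m :=
  WithLp.toLp 2
    (gradient f z.fst - ∑ i, z.snd i • gradient (fun y => g y i) z.fst,
      WithLp.toLp 2 fun i => plusProj (g z.fst i) (z.snd i))

end Problem

end PrimalDual

end

/-!
A saddle point `w` of the Lagrangian makes the duality gap `L(w.fst, z.snd) - L(z.fst, w.snd)`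
nonnegative, and by the gradient inequalities half of `‖γ t - w‖ ^ 2` decreases along a solution `γ`
at least at the rate of this gap. Hence distances to saddle points never increase, which gives
stability and boundedness, and the gap is integrable in time; being uniformly continuous it tends
to `0` (Barbalat's lemma). By strict concavity of `L(·, w.snd)` the primal part of `γ` then
converges to `w.fst`, so its velocity tends to `0` as well. These limits force every cluster point
of `γ` to be a saddle point, and since the distance to that cluster point is nonincreasing too, `γ`
converges to it.

The projection onto the half-spaces `λ i ≥ 0` makes the field discontinuous. For a continuous curve
`y` the running maximum of the negative part of `⟪e i, y⟫` is the least push that keeps `y` in the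
half-space, and it depends on `y` in a Lipschitz and causal way. Solutions of the projected
dynamics are thereby the reflections of the solutions `y` of a causal integral equation with
Lipschitz right-hand side, which Picard iteration solves for all times.
-/

namespace PrimalDual

section AbsoluteContinuity

theorem absolutelyContinuousOnInterval_comp {E Y : Type*} [SeminormedAddCommGroup E]
    [PseudoMetricSpace Y] {φ : E → Y} {γ : ℝ → E} {a b : ℝ} (hφ : LocallyLipschitz φ)
    (hγ : AbsolutelyContinuousOnInterval γ a b) :
    AbsolutelyContinuousOnInterval (fun t => φ (γ t)) a b := by
  have hrange : IsCompact (γ '' uIcc a b) := isCompact_uIcc.image_of_continuousOn hγ.continuousOn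
  obtain ⟨K, hK⟩ := hφ.locallyLipschitzOn.exists_lipschitzOnWith_of_compact hrange
  refine squeeze_zero' (Eventually.of_forall fun _ => Finset.sum_nonneg fun _ _ => dist_nonneg) ?_
    (by simpa only [mul_zero] using Tendsto.const_mul (K : ℝ) hγ)
  rw [eventually_inf_principal]
  refine Eventually.of_forall fun I hI => ?_
  rw [Finset.mul_sum]
  exact Finset.sum_le_sum fun i hi => hK.dist_le_mul _ (mem_image_of_mem γ (hI.1 i hi).1) _
    (mem_image_of_mem γ (hI.1 i hi).2)

theorem sub_le_integral_of_ae_hasDerivAt {h h' φ : ℝ → ℝ} {a b : ℝ} (hab : a ≤ b)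
    (hh : AbsolutelyContinuousOnInterval h a b) (hφ : IntervalIntegrable φ volume a b)
    (hderiv : ∀ᵐ t, t ∈ Ioo a b → HasDerivAt h (h' t) t ∧ h' t ≤ φ t) :
    h b - h a ≤ ∫ t in a..b, φ t := by
  rw [← hh.integral_deriv_eq_sub]
  refine intervalIntegral.integral_mono_ae_restrict hab hh.intervalIntegrable_deriv hφ ?_
  rw [EventuallyLE, ← restrict_Ioo_eq_restrict_Icc, ae_restrict_iff' measurableSet_Ioo]
  filter_upwards [hderiv] with t ht htab
  rw [(ht htab).1.deriv]
  exact (ht htab).2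

theorem sub_eq_integral_of_ae_hasDerivAt_real {h φ : ℝ → ℝ} {a b : ℝ} (hab : a ≤ b)
    (hh : AbsolutelyContinuousOnInterval h a b) (hφ : IntervalIntegrable φ volume a b)
    (hderiv : ∀ᵐ t, t ∈ Ioo a b → HasDerivAt h (φ t) t) :
    h b - h a = ∫ t in a..b, φ t := by
  refine le_antisymm (sub_le_integral_of_ae_hasDerivAt (h' := φ) hab hh hφ ?_) ?_
  · filter_upwards [hderiv] with t ht htab using ⟨ht htab, le_rfl⟩
  · have hneg := sub_le_integral_of_ae_hasDerivAt hab hh.neg hφ.neg (h' := -φ) (by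
      filter_upwards [hderiv] with t ht htab using ⟨(ht htab).neg, le_rfl⟩)
    simp only [Pi.neg_apply, intervalIntegral.integral_neg] at hneg
    linarith

theorem sub_eq_integral_of_ae_hasDerivAt {E : Type*} [NormedAddCommGroup E] [NormedSpace ℝ E]
    [CompleteSpace E] {h φ : ℝ → E} {a b : ℝ} (hab : a ≤ b)
    (hh : AbsolutelyContinuousOnInterval h a b) (hφ : IntervalIntegrable φ volume a b)
    (hderiv : ∀ᵐ t, t ∈ Ioo a b → HasDerivAt h (φ t) t) :
    h b - h a = ∫ t in a..b, φ t := by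
  refine (SeparatingDual.eq_iff_forall_dual_eq (R := ℝ)).2 fun ℓ => ?_
  rw [map_sub, ← ℓ.intervalIntegral_comp_comm hφ]
  refine sub_eq_integral_of_ae_hasDerivAt_real hab
    (absolutelyContinuousOnInterval_comp ℓ.lipschitz.locallyLipschitz hh)
    ⟨ℓ.integrable_comp hφ.1, ℓ.integrable_comp hφ.2⟩ ?_
  filter_upwards [hderiv] with t ht htab using ℓ.hasFDerivAt.comp_hasDerivAt t (ht htab)

theorem le_mul_exp_of_ae_hasDerivAt {h h' : ℝ → ℝ} {a b C : ℝ} (hab : a ≤ b)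
    (hh : AbsolutelyContinuousOnInterval h a b)
    (hderiv : ∀ᵐ t, t ∈ Ioo a b → HasDerivAt h (h' t) t ∧ h' t ≤ C * h t) :
    h b ≤ h a * Real.exp (C * (b - a)) := by
  have hexp : AbsolutelyContinuousOnInterval (fun t => Real.exp (C * (b - t))) a b :=
    ContDiffOn.absolutelyContinuousOnInterval
      (by fun_prop : ContDiff ℝ 1 fun t => Real.exp (C * (b - t))).contDiffOn
  have hle := sub_le_integral_of_ae_hasDerivAt (φ := 0) hab (hh.mul hexp)
    intervalIntegrable_const
    (h' := fun t => h' t * Real.exp (C * (b - t)) + h t * (Real.exp (C * (b - t)) * (C * -1))) (by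
      filter_upwards [hderiv] with t ht htab
      refine ⟨(ht htab).1.mul (((hasDerivAt_id t).const_sub b).const_mul C).exp, ?_⟩
      have := mul_le_mul_of_nonneg_right (ht htab).2 (Real.exp_pos (C * (b - t))).le
      simp only [Pi.zero_apply]
      linarith)
  simpa using hle

theorem norm_sub_le_of_ae_hasDerivAt {E : Type*} [NormedAddCommGroup E] [NormedSpace ℝ E]
    {γ γ' : ℝ → E} {a b M : ℝ} (hab : a ≤ b) (hγ : AbsolutelyContinuousOnInterval γ a b)
    (hderiv : ∀ᵐ t, t ∈ Ioo a b → HasDerivAt γ (γ' t) t ∧ ‖γ' t‖ ≤ M) :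
    ‖γ b - γ a‖ ≤ M * (b - a) := by
  obtain ⟨ℓ, hℓ, hℓγ⟩ := exists_dual_vector'' ℝ (γ b - γ a)
  have hac : AbsolutelyContinuousOnInterval (fun t => ℓ (γ t)) a b :=
    absolutelyContinuousOnInterval_comp ℓ.lipschitz.locallyLipschitz hγ
  have hle := sub_le_integral_of_ae_hasDerivAt (φ := fun _ => M) (h' := fun t => ℓ (γ' t)) hab hac
    intervalIntegrable_const (by
      filter_upwards [hderiv] with t ht htab
      refine ⟨ℓ.hasFDerivAt.comp_hasDerivAt t (ht htab).1, (le_abs_self _).trans ?_⟩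
      exact (ℓ.le_of_opNorm_le hℓ _).trans (by simpa using (ht htab).2))
  rw [← map_sub, hℓγ, intervalIntegral.integral_const, smul_eq_mul, mul_comm] at hle
  exact hle

theorem tendsto_zero_of_tendsto_integral {E : Type*} [NormedAddCommGroup E] [NormedSpace ℝ E]
    [CompleteSpace E] {ψ : ℝ → E} {a : E} (hψ : UniformContinuousOn ψ (Ici 0))
    (hint : Tendsto (fun t => ∫ s in (0 : ℝ)..t, ψ s) atTop (𝓝 a)) :
    Tendsto ψ atTop (𝓝 0) := by
  have hii : ∀ {s t : ℝ}, 0 ≤ s → 0 ≤ t → IntervalIntegrable ψ volume s t := fun hs ht =>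
    (hψ.continuousOn.mono (ordConnected_Ici.uIcc_subset hs ht)).intervalIntegrable
  rw [Metric.tendsto_nhds]
  intro ε hε
  obtain ⟨δ, hδ, hψδ⟩ := Metric.uniformContinuousOn_iff_le.1 hψ (ε / 2) (by positivity)
  have hwindow : Tendsto (fun t => (∫ s in (0 : ℝ)..(t + δ), ψ s) - ∫ s in (0 : ℝ)..t, ψ s) atTop
      (𝓝 0) := by
    simpa using (hint.comp (tendsto_atTop_add_const_right _ δ tendsto_id)).sub hint
  filter_upwards [Metric.tendsto_nhds.1 hwindow (δ * (ε / 2)) (by positivity),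
    eventually_ge_atTop 0] with t ht ht0
  have htδ : 0 ≤ t + δ := by positivity
  rw [intervalIntegral.integral_interval_sub_left (hii le_rfl htδ) (hii le_rfl ht0),
    dist_zero_right] at ht
  have hosc : ‖∫ s in t..(t + δ), (ψ s - ψ t)‖ ≤ ε / 2 * |t + δ - t| := by
    refine intervalIntegral.norm_integral_le_of_norm_le_const fun s hs => ?_
    rw [uIoc_of_le (by linarith)] at hs
    rw [← dist_eq_norm]
    refine hψδ s (ht0.trans hs.1.le) t ht0 ?_
    rw [Real.dist_eq, abs_of_pos (sub_pos.2 hs.1)]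
    linarith [hs.2]
  rw [add_sub_cancel_left, abs_of_pos hδ] at hosc
  have havg : δ • ψ t = (∫ s in t..(t + δ), ψ s) - ∫ s in t..(t + δ), (ψ s - ψ t) := by
    rw [intervalIntegral.integral_sub (hii ht0 htδ) intervalIntegrable_const,
      intervalIntegral.integral_const, add_sub_cancel_left, sub_sub_cancel]
  have hlt : δ * ‖ψ t‖ < δ * ε := by
    calc δ * ‖ψ t‖ = ‖δ • ψ t‖ := by rw [norm_smul, Real.norm_of_nonneg hδ.le]
      _ ≤ ‖∫ s in t..(t + δ), ψ s‖ + ‖∫ s in t..(t + δ), (ψ s - ψ t)‖ := by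
        rw [havg]
        exact norm_sub_le _ _
      _ < δ * ε := by linarith
  rw [dist_zero_right]
  exact lt_of_mul_lt_mul_left hlt hδ.le

end AbsoluteContinuity

section CausalIntegralEquation

open scoped NNReal BoundedContinuousFunction

variable {E F G : Type*} [NormedAddCommGroup E] [NormedAddCommGroup F] [NormedAddCommGroup G]
  {C : ℝ≥0}

/-- An operator on curves whose value at time `t ≥ 0` depends on the curve up to time `t` only,
with Lipschitz constant `C` for the supremum norm. -/
structure IsCausalLipschitz (C : ℝ≥0) (Q : (ℝ → E) → ℝ → F) : Prop where
  continuous_apply : ∀ {u}, Continuous u → Continuous (Q u)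
  norm_sub_le : ∀ {u v}, Continuous u → Continuous v → ∀ {t M : ℝ}, 0 ≤ t →
    (∀ s ∈ Icc 0 t, ‖u s - v s‖ ≤ M) → ‖Q u t - Q v t‖ ≤ C * M

theorem IsCausalLipschitz.comp {K : ℝ≥0} {A : F → G} {Q : (ℝ → E) → ℝ → F} (hA : LipschitzWith K A)
    (hQ : IsCausalLipschitz C Q) : IsCausalLipschitz (K * C) fun u t => A (Q u t) where
  continuous_apply hu := hA.continuous.comp (hQ.continuous_apply hu)
  norm_sub_le hu hv _ _ ht h := by
    rw [NNReal.coe_mul, mul_assoc]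
    refine (hA.norm_sub_le _ _).trans ?_
    gcongr
    exact hQ.norm_sub_le hu hv ht h

variable [NormedSpace ℝ E]

/-- The curve on the line whose restriction to `t ≥ 0` has the weighted values
`e^{-ct} u(t) = v(t)`. -/
noncomputable def expUnweight (c : ℝ) (v : ℝ≥0 →ᵇ E) (t : ℝ) : E := Real.exp (c * t) • v t.toNNReal

/-- The Picard operator of `u(t) = z₀ + ∫₀ᵗ Q(u)`, acting on the weighted curves
`v(t) = e^{-ct} u(t)`: for large `c` it is a contraction on all of `[0, ∞)`. -/
noncomputable def weightedPicard (c : ℝ) (Q : (ℝ → E) → ℝ → E) (z₀ : E) (v : ℝ≥0 →ᵇ E) (t : ℝ) :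
    E :=
  Real.exp (-(c * t)) • (z₀ + ∫ s in (0 : ℝ)..t, Q (expUnweight c v) s)

variable {B c t : ℝ} {v w : ℝ≥0 →ᵇ E} {z₀ : E}

theorem continuous_expUnweight (c : ℝ) (v : ℝ≥0 →ᵇ E) : Continuous (expUnweight c v) :=
  (by fun_prop : Continuous fun t : ℝ => Real.exp (c * t)).smul
    (v.continuous.comp continuous_real_toNNReal)

theorem expUnweight_zero (c : ℝ) : expUnweight c (0 : ℝ≥0 →ᵇ E) = 0 := by
  funext t
  simp [expUnweight]

theorem norm_expUnweight_sub_le (c t : ℝ) (v w : ℝ≥0 →ᵇ E) :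
    ‖expUnweight c v t - expUnweight c w t‖ ≤ dist v w * Real.exp (c * t) := by
  rw [expUnweight, expUnweight, ← smul_sub, norm_smul, Real.norm_of_nonneg (Real.exp_nonneg _),
    mul_comm, ← dist_eq_norm]
  gcongr
  exact BoundedContinuousFunction.dist_coe_le_dist _

theorem norm_integral_le_mul_exp {φ : ℝ → E} {D : ℝ} (hc : 0 < c) (ht : 0 ≤ t)
    (hφ : ∀ s ∈ Icc 0 t, ‖φ s‖ ≤ D * Real.exp (c * s)) :
    ‖∫ s in (0 : ℝ)..t, φ s‖ ≤ D / c * Real.exp (c * t) := by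
  have hD : 0 ≤ D := by simpa using (norm_nonneg _).trans (hφ 0 (left_mem_Icc.2 ht))
  have hexp : ∫ s in (0 : ℝ)..t, Real.exp (c * s) = (Real.exp (c * t) - 1) / c := by
    rw [intervalIntegral.integral_comp_mul_left (fun x => Real.exp x) hc.ne', integral_exp,
      mul_zero, Real.exp_zero, smul_eq_mul, inv_mul_eq_div]
  calc ‖∫ s in (0 : ℝ)..t, φ s‖ ≤ ∫ s in (0 : ℝ)..t, D * Real.exp (c * s) :=
        intervalIntegral.norm_integral_le_of_norm_le ht
          (Eventually.of_forall fun s hs => hφ s (Ioc_subset_Icc_self hs))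
          (Continuous.intervalIntegrable (by fun_prop) 0 t)
    _ = D * ((Real.exp (c * t) - 1) / c) := by rw [intervalIntegral.integral_const_mul, hexp]
    _ ≤ D * (Real.exp (c * t) / c) := by gcongr; linarith
    _ = D / c * Real.exp (c * t) := by ring

namespace IsCausalLipschitz

theorem norm_expUnweight_sub_le {Q : (ℝ → E) → ℝ → F} (hQ : IsCausalLipschitz C Q) (hc : 0 ≤ c)
    (ht : 0 ≤ t) (v w : ℝ≥0 →ᵇ E) :
    ‖Q (expUnweight c v) t - Q (expUnweight c w) t‖ ≤ C * dist v w * Real.exp (c * t) := by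
  rw [mul_assoc]
  refine hQ.norm_sub_le (continuous_expUnweight c v) (continuous_expUnweight c w) ht fun s hs =>
    (PrimalDual.norm_expUnweight_sub_le c s v w).trans ?_
  gcongr
  exact hs.2

variable {Q : (ℝ → E) → ℝ → E}

theorem continuous_weightedPicard (hQ : IsCausalLipschitz C Q) :
    Continuous (weightedPicard c Q z₀ v) := by
  have hprim : Continuous fun t : ℝ => ∫ s in (0 : ℝ)..t, Q (expUnweight c v) s :=
    intervalIntegral.continuous_primitive
      (hQ.continuous_apply (continuous_expUnweight c v)).intervalIntegrable 0
  unfold weightedPicard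
  fun_prop

theorem norm_weightedPicard_le (hQ : IsCausalLipschitz C Q) (hB : ∀ t, ‖Q 0 t‖ ≤ B)
    (hc : 0 < c) (ht : 0 ≤ t) :
    ‖weightedPicard c Q z₀ v t‖ ≤ ‖z₀‖ + (C * ‖v‖ + B) / c := by
  have hB₀ : 0 ≤ B := (norm_nonneg _).trans (hB 0)
  have hgrowth : ∀ s ∈ Icc 0 t, ‖Q (expUnweight c v) s‖ ≤ (C * ‖v‖ + B) * Real.exp (c * s) := by
    intro s hs
    have hdiff := hQ.norm_expUnweight_sub_le hc.le hs.1 v 0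
    rw [dist_zero_right, expUnweight_zero] at hdiff
    have hone : 1 ≤ Real.exp (c * s) := Real.one_le_exp (mul_nonneg hc.le hs.1)
    calc ‖Q (expUnweight c v) s‖ ≤ ‖Q (expUnweight c v) s - Q 0 s‖ + ‖Q 0 s‖ := by
          simpa using norm_add_le (Q (expUnweight c v) s - Q 0 s) (Q 0 s)
      _ ≤ C * ‖v‖ * Real.exp (c * s) + B := add_le_add hdiff (hB s)
      _ ≤ (C * ‖v‖ + B) * Real.exp (c * s) := by nlinarith
  have hone : 1 ≤ Real.exp (c * t) := Real.one_le_exp (mul_nonneg hc.le ht)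
  rw [weightedPicard, norm_smul, Real.norm_of_nonneg (Real.exp_nonneg _), Real.exp_neg,
    inv_mul_le_iff₀ (Real.exp_pos _)]
  refine (norm_add_le _ _).trans ?_
  nlinarith [norm_nonneg z₀, norm_integral_le_mul_exp hc ht hgrowth]

theorem norm_weightedPicard_sub_le (hQ : IsCausalLipschitz C Q) (hc : 0 < c) (ht : 0 ≤ t) :
    ‖weightedPicard c Q z₀ v t - weightedPicard c Q z₀ w t‖ ≤ C / c * dist v w := by
  have hint : ∀ v, IntervalIntegrable (Q (expUnweight c v)) volume 0 t := fun v =>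
    (hQ.continuous_apply (continuous_expUnweight c v)).intervalIntegrable 0 t
  rw [weightedPicard, weightedPicard, ← smul_sub, add_sub_add_left_eq_sub, norm_smul,
    Real.norm_of_nonneg (Real.exp_nonneg _), Real.exp_neg, inv_mul_le_iff₀ (Real.exp_pos _),
    ← intervalIntegral.integral_sub (hint v) (hint w)]
  refine (norm_integral_le_mul_exp hc ht fun s hs =>
    hQ.norm_expUnweight_sub_le hc.le hs.1 v w).trans_eq ?_
  ring

variable [CompleteSpace E]

theorem exists_eq_add_integral (hQ : IsCausalLipschitz C Q) (hB : ∀ t, ‖Q 0 t‖ ≤ B) (z₀ : E) :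
    ∃ u : ℝ → E, Continuous u ∧ ∀ t, 0 ≤ t → u t = z₀ + ∫ s in (0 : ℝ)..t, Q u s := by
  set c : ℝ≥0 := C + 1
  have hc : 0 < (c : ℝ) := by positivity
  let Φ : (ℝ≥0 →ᵇ E) → (ℝ≥0 →ᵇ E) := fun v =>
    BoundedContinuousFunction.ofNormedAddCommGroup (fun t : ℝ≥0 => weightedPicard c Q z₀ v t)
      (hQ.continuous_weightedPicard.comp NNReal.continuous_coe) _
      fun t => hQ.norm_weightedPicard_le hB hc t.2
  have hΦ : ContractingWith (C / c) Φ := by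
    refine ⟨(div_lt_one (NNReal.coe_pos.1 hc)).2 (lt_add_one C),
      LipschitzWith.of_dist_le_mul fun v w => ?_⟩
    refine (BoundedContinuousFunction.dist_le (by positivity)).2 fun t => ?_
    rw [dist_eq_norm, NNReal.coe_div]
    exact hQ.norm_weightedPicard_sub_le hc t.2
  obtain ⟨v, hv⟩ : ∃ v, Φ v = v := ⟨_, hΦ.fixedPoint_isFixedPt⟩
  refine ⟨expUnweight c v, continuous_expUnweight c v, fun t ht => ?_⟩
  have hvt : weightedPicard c Q z₀ v t = v t.toNNReal := by
    rw [← DFunLike.congr_fun hv, BoundedContinuousFunction.coe_ofNormedAddCommGroup,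
      Real.coe_toNNReal t ht]
  rw [expUnweight, ← hvt, weightedPicard, smul_smul, ← Real.exp_add, add_neg_cancel,
    Real.exp_zero, one_smul]

theorem exists_hasDerivAt (hQ : IsCausalLipschitz C Q) (hB : ∀ t, ‖Q 0 t‖ ≤ B) (z₀ : E) :
    ∃ u : ℝ → E, Continuous u ∧ u 0 = z₀ ∧ (∀ t, 0 < t → HasDerivAt u (Q u t) t) ∧
      ∀ b, ∃ K, LipschitzOnWith K u (Icc 0 b) := by
  obtain ⟨u, hu, hint⟩ := hQ.exists_eq_add_integral hB z₀
  have hprim : ∀ t, HasDerivAt (fun t => z₀ + ∫ s in (0 : ℝ)..t, Q u s) (Q u t) t := fun t =>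
    ((hQ.continuous_apply hu).integral_hasStrictDerivAt 0 t).hasDerivAt.const_add z₀
  refine ⟨u, hu, by simpa using hint 0 le_rfl, fun t ht => ?_, fun b => ?_⟩
  · refine (hprim t).congr_of_eventuallyEq ?_
    filter_upwards [lt_mem_nhds ht] with s hs using hint s hs.le
  · obtain ⟨M, hM⟩ := isCompact_Icc.exists_bound_of_continuousOn (s := Icc 0 b)
      (hQ.continuous_apply hu).continuousOn
    refine ⟨M.toNNReal, (convex_Icc 0 b).lipschitzOnWith_of_nnnorm_hasDerivWithin_le
      (fun t ht => (hprim t).hasDerivWithinAt.congr (fun s hs => hint s hs.1) (hint t ht.1))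
      fun t ht => ?_⟩
    rw [← NNReal.coe_le_coe, coe_nnnorm]
    exact (hM t ht).trans (Real.le_coe_toNNReal M)

end IsCausalLipschitz

end CausalIntegralEquation

section SkorokhodReflection

open scoped NNReal

/-- The Skorokhod regulator `ℓ(t) = max_{0 ≤ s ≤ t} (-u(s))⁺`: the least nondecreasing function
for which `u + ℓ ≥ 0`. The maximum is taken over the fixed interval `[0, 1]`, with `s = r t`, so
that continuity in `t` is the continuity of a supremum over a compact set of parameters. -/
noncomputable def skorokhodRegulator (u : ℝ → ℝ) (t : ℝ) : ℝ :=
  sSup ((fun r => max 0 (-u (r * t))) '' Icc 0 1)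

variable {u v : ℝ → ℝ} {s t M : ℝ}

theorem continuous_skorokhodRegulator (hu : Continuous u) : Continuous (skorokhodRegulator u) :=
  isCompact_Icc.continuous_sSup (f := fun t r => max 0 (-u (r * t)))
    (by simp only [Function.HasUncurry.uncurry]; fun_prop)

theorem skorokhodRegulator_le (ht : 0 ≤ t) (hM : 0 ≤ M) (h : ∀ s ∈ Icc 0 t, -u s ≤ M) :
    skorokhodRegulator u t ≤ M := by
  refine csSup_le ((nonempty_Icc.2 zero_le_one).image _) ?_
  rintro _ ⟨r, hr, rfl⟩
  exact max_le hM (h _ ⟨mul_nonneg hr.1 ht, mul_le_of_le_one_left ht hr.2⟩)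

theorem max_neg_le_skorokhodRegulator (hu : Continuous u) (hs : s ∈ Icc 0 t) :
    max 0 (-u s) ≤ skorokhodRegulator u t := by
  have hbdd : BddAbove ((fun r => max 0 (-u (r * t))) '' Icc 0 1) :=
    isCompact_Icc.bddAbove_image (by fun_prop)
  have ht : 0 ≤ t := hs.1.trans hs.2
  refine le_csSup hbdd ⟨s / t, ⟨div_nonneg hs.1 ht, div_le_one_of_le₀ hs.2 ht⟩, ?_⟩
  have hst : s / t * t = s := div_mul_cancel_of_imp fun h => le_antisymm (h ▸ hs.2) hs.1
  simp only [hst]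

theorem skorokhodRegulator_nonneg (hu : Continuous u) (ht : 0 ≤ t) : 0 ≤ skorokhodRegulator u t :=
  (le_max_left _ _).trans (max_neg_le_skorokhodRegulator hu (right_mem_Icc.2 ht))

theorem neg_le_skorokhodRegulator (hu : Continuous u) (hs : s ∈ Icc 0 t) :
    -u s ≤ skorokhodRegulator u t :=
  (le_max_right _ _).trans (max_neg_le_skorokhodRegulator hu hs)

theorem add_skorokhodRegulator_nonneg (hu : Continuous u) (ht : 0 ≤ t) :
    0 ≤ u t + skorokhodRegulator u t := by
  linarith [neg_le_skorokhodRegulator hu (right_mem_Icc.2 ht)]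

theorem skorokhodRegulator_eq_zero (h : 0 ≤ u 0) : skorokhodRegulator u 0 = 0 := by
  simp [skorokhodRegulator, h]

theorem skorokhodRegulator_le_add (hv : Continuous v) (ht : 0 ≤ t)
    (h : ∀ s ∈ Icc 0 t, |u s - v s| ≤ M) :
    skorokhodRegulator u t ≤ skorokhodRegulator v t + M := by
  have hM : 0 ≤ M := (abs_nonneg _).trans (h 0 (left_mem_Icc.2 ht))
  refine skorokhodRegulator_le ht (add_nonneg (skorokhodRegulator_nonneg hv ht) hM) fun s hs => ?_
  linarith [neg_le_skorokhodRegulator hv hs, neg_le_of_abs_le (h s hs)]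

theorem abs_skorokhodRegulator_sub_le (hu : Continuous u) (hv : Continuous v) (ht : 0 ≤ t)
    (h : ∀ s ∈ Icc 0 t, |u s - v s| ≤ M) :
    |skorokhodRegulator u t - skorokhodRegulator v t| ≤ M :=
  abs_sub_le_iff.2 ⟨sub_le_iff_le_add'.2 (skorokhodRegulator_le_add hv ht h),
    sub_le_iff_le_add'.2
      (skorokhodRegulator_le_add hu ht fun s hs => abs_sub_comm (u s) (v s) ▸ h s hs)⟩

theorem monotoneOn_skorokhodRegulator (hu : Continuous u) :
    MonotoneOn (skorokhodRegulator u) (Ici 0) := fun _ hs _ _ hst =>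
  skorokhodRegulator_le hs (skorokhodRegulator_nonneg hu (le_trans hs hst)) fun _ hr =>
    neg_le_skorokhodRegulator hu ⟨hr.1, hr.2.trans hst⟩

theorem lipschitzOnWith_skorokhodRegulator (hu : Continuous u) {b : ℝ} {K : ℝ≥0}
    (hK : LipschitzOnWith K u (Icc 0 b)) : LipschitzOnWith K (skorokhodRegulator u) (Icc 0 b) := by
  refine LipschitzOnWith.of_le_add_mul K fun t ht s hs => ?_
  have hnonneg : 0 ≤ K * dist t s := by positivity
  rcases le_total t s with hts | hst
  · exact (monotoneOn_skorokhodRegulator hu ht.1 hs.1 hts).trans (le_add_of_nonneg_right hnonneg)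
  refine skorokhodRegulator_le ht.1 (add_nonneg (skorokhodRegulator_nonneg hu hs.1) hnonneg)
    fun r hr => ?_
  rcases le_total r s with hrs | hsr
  · linarith [neg_le_skorokhodRegulator hu ⟨hr.1, hrs⟩]
  have hur : u s ≤ u r + K * dist s r := hK.le_add_mul hs ⟨hr.1, hr.2.trans ht.2⟩
  have hdist : K * dist s r ≤ K * dist t s := by
    rw [dist_comm s, Real.dist_eq, Real.dist_eq, abs_of_nonneg (sub_nonneg.2 hsr),
      abs_of_nonneg (sub_nonneg.2 hst)]
    gcongr
    exact hr.2
  linarith [neg_le_skorokhodRegulator hu (right_mem_Icc.2 hs.1)]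

theorem skorokhodRegulator_eq_of_forall_neg_le (hu : Continuous u) (hs : 0 ≤ s) (hst : s ≤ t)
    (h : ∀ r ∈ Icc s t, -u r ≤ skorokhodRegulator u s) :
    skorokhodRegulator u t = skorokhodRegulator u s := by
  refine le_antisymm (skorokhodRegulator_le (hs.trans hst) (skorokhodRegulator_nonneg hu hs)
    fun r hr => ?_) (monotoneOn_skorokhodRegulator hu hs (hs.trans hst) hst)
  rcases le_total r s with hrs | hsr
  · exact neg_le_skorokhodRegulator hu ⟨hr.1, hrs⟩
  · exact h r ⟨hsr, hr.2⟩

theorem eventually_skorokhodRegulator_eq (hu : Continuous u) (ht : 0 < t)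
    (hpos : 0 < u t + skorokhodRegulator u t) :
    ∀ᶠ s in 𝓝 t, skorokhodRegulator u s = skorokhodRegulator u t := by
  have hcont : ContinuousAt (fun q : ℝ × ℝ => u q.1 + skorokhodRegulator u q.2) (t, t) := by
    have := continuous_skorokhodRegulator hu
    fun_prop
  obtain ⟨δ, hδ, hball⟩ := Metric.eventually_nhds_iff_ball.1 (hcont.eventually_const_lt hpos)
  rw [← ball_prod_same] at hball
  have hneg : ∀ r ∈ Metric.ball t δ, ∀ s ∈ Metric.ball t δ, -u r ≤ skorokhodRegulator u s :=
    fun r hr s hs => by linarith [hball (r, s) ⟨hr, hs⟩]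
  have hδt : t ∈ Metric.ball t δ := Metric.mem_ball_self hδ
  filter_upwards [Metric.ball_mem_nhds t hδ, lt_mem_nhds ht] with s hs hs₀
  have hconv : (Metric.ball t δ).OrdConnected := (convex_ball t δ).ordConnected
  rcases le_total s t with hst | hts
  · exact (skorokhodRegulator_eq_of_forall_neg_le hu hs₀.le hst fun r hr =>
      hneg r (hconv.out hs hδt hr) s hs).symm
  · exact skorokhodRegulator_eq_of_forall_neg_le hu ht.le hts fun r hr =>
      hneg r (hconv.out hδt hs hr) t hδt

/- Where the reflected path vanishes it has a minimum, so there the regulator cancels `u'`. -/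
theorem ae_hasDerivAt_skorokhodRegulator (hu : Continuous u) {u' : ℝ → ℝ}
    (hderiv : ∀ t, 0 < t → HasDerivAt u (u' t) t) :
    ∀ᵐ t, 0 < t → HasDerivAt (skorokhodRegulator u)
      (plusProj (u' t) (u t + skorokhodRegulator u t) - u' t) t := by
  filter_upwards [(monotoneOn_skorokhodRegulator hu).ae_differentiableWithinAt_of_mem]
    with t hdiff ht
  unfold plusProj
  split_ifs with hpos
  · rw [sub_self]
    exact (hasDerivAt_const t _).congr_of_eventuallyEq (eventually_skorokhodRegulator_eq hu ht hpos)
  have hreg : HasDerivAt (skorokhodRegulator u) (deriv (skorokhodRegulator u) t) t :=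
    ((hdiff ht.le).differentiableAt (Ici_mem_nhds ht)).hasDerivAt
  have hreg_nonneg : 0 ≤ deriv (skorokhodRegulator u) t := by
    rw [← derivWithin_of_mem_nhds (Ici_mem_nhds ht)]
    exact (monotoneOn_skorokhodRegulator hu).derivWithin_nonneg
  have hmin : IsLocalMin (u + skorokhodRegulator u) t := by
    filter_upwards [lt_mem_nhds ht] with s hs
    exact (not_lt.1 hpos).trans (add_skorokhodRegulator_nonneg hu hs.le)
  have hcancel : u' t + deriv (skorokhodRegulator u) t = 0 :=
    hmin.hasDerivAt_eq_zero ((hderiv t ht).add hreg)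
  rwa [max_eq_left (by linarith), show 0 - u' t = deriv (skorokhodRegulator u) t by linarith]

end SkorokhodReflection

section OrthantReflection

open scoped NNReal InnerProductSpace

variable {E ι : Type*} [NormedAddCommGroup E] [InnerProductSpace ℝ E]

/-- The points whose coordinates along the vectors `e i` are nonnegative. -/
def orthant (e : ι → E) : Set E := {z | ∀ i, 0 ≤ ⟪e i, z⟫_ℝ}

theorem isClosed_orthant (e : ι → E) : IsClosed (orthant e) := by
  simp only [orthant, ofPred_forall]
  exact isClosed_iInter fun i => isClosed_le continuous_const (by fun_prop)

theorem le_plusProj (a b : ℝ) : a ≤ plusProj a b := by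
  unfold plusProj
  split_ifs <;> simp

theorem plusProj_mul_plusProj_sub (a b : ℝ) : plusProj a b * (plusProj a b - a) = 0 := by
  unfold plusProj
  split_ifs
  · simp
  · rcases le_total a 0 with h | h <;> simp [h]

theorem plusProj_sub_mul_eq_zero (a : ℝ) {b : ℝ} (hb : 0 ≤ b) : (plusProj a b - a) * b = 0 := by
  unfold plusProj
  split_ifs with h
  · simp
  · simp [le_antisymm (not_lt.1 h) hb]

theorem abs_inner_sub_inner_le {e : E} (he : ‖e‖ = 1) (a b : E) :
    |⟪e, a⟫_ℝ - ⟪e, b⟫_ℝ| ≤ ‖a - b‖ := by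
  rw [← inner_sub_right]
  simpa [he] using abs_real_inner_le_norm e (a - b)

variable [Fintype ι]

/-- The velocity `v` at the point `z` of `orthant e`, with its components that point out of the
orthant removed. For orthonormal `e` this is the projection of `v` onto the tangent cone at `z`. -/
noncomputable def projectVelocity (e : ι → E) (v z : E) : E :=
  v + ∑ i, (plusProj ⟪e i, v⟫_ℝ ⟪e i, z⟫_ℝ - ⟪e i, v⟫_ℝ) • e i

/-- The path `u` with its coordinates along the vectors `e i` reflected at `0`. -/
noncomputable def reflectedPath (e : ι → E) (u : ℝ → E) (t : ℝ) : E :=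
  u t + ∑ i, skorokhodRegulator (fun s => ⟪e i, u s⟫_ℝ) t • e i

variable {e : ι → E}

theorem inner_sub_projectVelocity_le {z w : E} (hz : z ∈ orthant e) (hw : w ∈ orthant e) (v : E) :
    ⟪z - w, projectVelocity e v z⟫_ℝ ≤ ⟪z - w, v⟫_ℝ := by
  rw [projectVelocity, inner_add_right, inner_sum, add_le_iff_nonpos_right]
  refine Finset.sum_nonpos fun i _ => ?_
  have hzi := plusProj_sub_mul_eq_zero ⟪e i, v⟫_ℝ (hz i)
  have hwi := mul_nonneg (sub_nonneg.2 (le_plusProj ⟪e i, v⟫_ℝ ⟪e i, z⟫_ℝ)) (hw i)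
  rw [real_inner_smul_right, real_inner_comm (e i), inner_sub_right, mul_sub, hzi]
  linarith

section Orthonormal

variable (he : Orthonormal ℝ e)
include he

theorem inner_add_sum_smul (i : ι) (z : E) (p : ι → ℝ) :
    ⟪e i, z + ∑ j, p j • e j⟫_ℝ = ⟪e i, z⟫_ℝ + p i := by
  rw [inner_add_right, he.inner_right_fintype]

theorem norm_projectVelocity_le (v z : E) : ‖projectVelocity e v z‖ ≤ ‖v‖ := by
  have horth : ⟪projectVelocity e v z, projectVelocity e v z - v⟫_ℝ = 0 := by
    rw [projectVelocity, add_sub_cancel_left, inner_sum]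
    refine Finset.sum_eq_zero fun i _ => ?_
    rw [real_inner_smul_right, real_inner_comm (e i), inner_add_sum_smul he, add_sub_cancel,
      mul_comm, plusProj_mul_plusProj_sub]
  rw [inner_sub_right, real_inner_self_eq_norm_mul_norm, sub_eq_zero] at horth
  have hle := real_inner_le_norm (projectVelocity e v z) v
  rw [← horth] at hle
  by_contra! hlt
  nlinarith [norm_nonneg v]

theorem norm_add_sum_smul_sub_le {a b : E} {p q : ι → ℝ} {M : ℝ} (hab : ‖a - b‖ ≤ M)
    (hpq : ∀ i, |p i - q i| ≤ M) :
    ‖(a + ∑ i, p i • e i) - (b + ∑ i, q i • e i)‖ ≤ (1 + Fintype.card ι) * M := by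
  have hsum : ‖∑ i, (p i - q i) • e i‖ ≤ Fintype.card ι * M := by
    refine (norm_sum_le _ _).trans ((Finset.sum_le_card_nsmul _ _ M fun i _ => ?_).trans_eq
      (nsmul_eq_mul _ _))
    simpa [norm_smul, he.norm_eq_one] using hpq i
  rw [add_sub_add_comm, ← Finset.sum_sub_distrib]
  simp only [← sub_smul]
  linarith [norm_add_le (a - b) (∑ i, (p i - q i) • e i)]

theorem isCausalLipschitz_reflectedPath :
    IsCausalLipschitz (1 + Fintype.card ι) (reflectedPath e) where
  continuous_apply hu := by
    have hreg := fun i => continuous_skorokhodRegulator (u := fun s => ⟪e i, _⟫_ℝ)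
      (continuous_const.inner hu)
    unfold reflectedPath
    fun_prop
  norm_sub_le hu hv t M ht h := by
    push_cast
    exact norm_add_sum_smul_sub_le he (h t (right_mem_Icc.2 ht)) fun i =>
      abs_skorokhodRegulator_sub_le (continuous_const.inner hu) (continuous_const.inner hv) ht
        fun s hs => (abs_inner_sub_inner_le (he.norm_eq_one i) _ _).trans (h s hs)

variable {u : ℝ → E}

theorem reflectedPath_mem_orthant (hu : Continuous u) {t : ℝ} (ht : 0 ≤ t) :
    reflectedPath e u t ∈ orthant e := fun i => by
  rw [reflectedPath, inner_add_sum_smul he]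
  exact add_skorokhodRegulator_nonneg (continuous_const.inner hu) ht

theorem lipschitzOnWith_reflectedPath (hu : Continuous u) {b : ℝ} {K : ℝ≥0}
    (hK : LipschitzOnWith K u (Icc 0 b)) :
    LipschitzOnWith ((1 + Fintype.card ι) * K) (reflectedPath e u) (Icc 0 b) := by
  have hcoord : ∀ i, LipschitzOnWith K (fun s => ⟪e i, u s⟫_ℝ) (Icc 0 b) := fun i =>
    LipschitzOnWith.of_dist_le_mul fun s hs t ht =>
      (abs_inner_sub_inner_le (he.norm_eq_one i) _ _).trans (by
        simpa [dist_eq_norm] using hK.dist_le_mul s hs t ht)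
  refine LipschitzOnWith.of_dist_le_mul fun s hs t ht => ?_
  push_cast
  rw [mul_assoc, dist_eq_norm]
  exact norm_add_sum_smul_sub_le he (by simpa [dist_eq_norm] using hK.dist_le_mul s hs t ht)
    fun i => (lipschitzOnWith_skorokhodRegulator (continuous_const.inner hu)
      (hcoord i)).dist_le_mul s hs t ht

theorem ae_hasDerivAt_reflectedPath (hu : Continuous u) {u' : ℝ → E}
    (hderiv : ∀ t, 0 < t → HasDerivAt u (u' t) t) :
    ∀ᵐ t, 0 < t →
      HasDerivAt (reflectedPath e u) (projectVelocity e (u' t) (reflectedPath e u t)) t := by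
  have hreg := fun i => ae_hasDerivAt_skorokhodRegulator (u := fun s => ⟪e i, u s⟫_ℝ)
    (continuous_const.inner hu) fun t ht => (innerSL ℝ (e i)).hasFDerivAt.comp_hasDerivAt t
      (hderiv t ht)
  filter_upwards [ae_all_iff.2 hreg] with t ht ht₀
  refine ((hderiv t ht₀).fun_add (HasDerivAt.fun_sum fun i _ =>
    (ht i ht₀).smul_const (e i))).congr_deriv ?_
  simp only [projectVelocity, reflectedPath, inner_add_sum_smul he, innerSL_apply_apply]

theorem exists_isCaratheodorySolution_of_lipschitzWith [CompleteSpace E] {A : E → E} {K : ℝ≥0}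
    (hA : LipschitzWith K A) {z₀ : E} (hz₀ : z₀ ∈ orthant e) :
    ∃ γ : ℝ → E, IsCaratheodorySolution (orthant e) (fun z => projectVelocity e (A z) z) ⊤ γ ∧
      γ 0 = z₀ := by
  have hbound : ∀ t, ‖A (reflectedPath e 0 t)‖ ≤ ‖A 0‖ := fun t => by
    simp [reflectedPath, skorokhodRegulator]
  obtain ⟨u, hu, hu₀, hderiv, hlip⟩ :=
    ((isCausalLipschitz_reflectedPath he).comp hA).exists_hasDerivAt hbound z₀
  refine ⟨reflectedPath e u, ⟨EReal.zero_lt_top, fun t ht _ => reflectedPath_mem_orthant he hu ht,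
    fun b hb _ => ?_, ?_⟩, ?_⟩
  · obtain ⟨M, hM⟩ := hlip b
    rw [← uIcc_of_le hb] at hM
    exact (uIcc_of_le hb ▸ lipschitzOnWith_reflectedPath he hu
      (uIcc_of_le hb ▸ hM)).absolutelyContinuousOnInterval
  · filter_upwards [ae_hasDerivAt_reflectedPath he hu hderiv, Measure.ae_ne volume 0]
      with t ht ht₀ ht_nonneg _ using ht (ht_nonneg.lt_of_ne' ht₀)
  · have hreg : ∀ i, skorokhodRegulator (fun s => ⟪e i, u s⟫_ℝ) 0 = 0 := fun i =>
      skorokhodRegulator_eq_zero (hu₀.symm ▸ hz₀ i)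
    simp [reflectedPath, hreg, hu₀]

end Orthonormal

end OrthantReflection

section CaratheodorySolutions

open scoped NNReal InnerProductSpace

variable {E : Type*} [NormedAddCommGroup E] [InnerProductSpace ℝ E] {K S : Set E} {X : E → E}

/-- The field `X` on `K` never points away from `w`, so that the distance to `w` is a Lyapunov
function of `γ' = X(γ)`. -/
def IsDissipativeAbout (K : Set E) (X : E → E) (w : E) : Prop :=
  ∀ z ∈ K, ⟪z - w, X z⟫_ℝ ≤ 0

/-- The one-sided Lipschitz condition with constant `C`, which makes `γ' = X(γ)` have at most one
solution from a given point although `X` may be discontinuous. -/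
def IsOneSidedLipschitzOn (C : ℝ) (X : E → E) (K : Set E) : Prop :=
  ∀ z ∈ K, ∀ w ∈ K, ⟪z - w, X z - X w⟫_ℝ ≤ C * ‖z - w‖ ^ 2

namespace IsCaratheodorySolution

variable {T T' : EReal} {γ η : ℝ → E} {w : E} {s t : ℝ}

theorem absCont_of_nonneg (hγ : IsCaratheodorySolution K X T γ) (hs : 0 ≤ s) (hst : s ≤ t)
    (ht : (t : EReal) < T) : AbsolutelyContinuousOnInterval γ s t := by
  refine (hγ.absCont t (hs.trans hst) ht).mono ?_
  rw [uIcc_of_le hst, uIcc_of_le (hs.trans hst)]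
  exact Icc_subset_Icc_left hs

theorem continuousOn_Icc (hγ : IsCaratheodorySolution K X T γ) (ht₀ : 0 ≤ t)
    (ht : (t : EReal) < T) : ContinuousOn γ (Icc 0 t) := by
  simpa only [uIcc_of_le ht₀] using (hγ.absCont t ht₀ ht).continuousOn

theorem mapsTo_Icc (hγ : IsCaratheodorySolution K X T γ) (ht : (t : EReal) < T) :
    MapsTo γ (Icc 0 t) K := fun s hs =>
  hγ.mem s hs.1 ((EReal.coe_le_coe_iff.2 hs.2).trans_lt ht)

theorem ae_hasDerivAt (hγ : IsCaratheodorySolution K X T γ) (hs : 0 ≤ s) (ht : (t : EReal) < T) :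
    ∀ᵐ r, r ∈ Ioo s t → HasDerivAt γ (X (γ r)) r := by
  filter_upwards [hγ.ode] with r hr hrst
  exact hr (hs.trans hrst.1.le) ((EReal.coe_lt_coe_iff.2 hrst.2).trans ht)

theorem norm_sub_sq_add_integral_le (hγ : IsCaratheodorySolution K X T γ) {φ : ℝ → ℝ} (hs : 0 ≤ s)
    (hst : s ≤ t) (ht : (t : EReal) < T) (hφ : IntervalIntegrable φ volume s t)
    (hinner : ∀ r ∈ Ioo s t, ⟪γ r - w, X (γ r)⟫_ℝ ≤ -φ r) :
    ‖γ t - w‖ ^ 2 + 2 * ∫ r in s..t, φ r ≤ ‖γ s - w‖ ^ 2 := by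
  have hsq : LocallyLipschitz fun z : E => ‖z - w‖ ^ 2 :=
    ((contDiff_id.sub contDiff_const).norm_sq ℝ).locallyLipschitz
  have hle := sub_le_integral_of_ae_hasDerivAt hst
    (absolutelyContinuousOnInterval_comp hsq (hγ.absCont_of_nonneg hs hst ht)) (hφ.const_mul (-2))
    (h' := fun r => 2 * ⟪γ r - w, X (γ r)⟫_ℝ) (by
      filter_upwards [hγ.ae_hasDerivAt hs ht] with r hr hrst
      exact ⟨((hr hrst).sub_const w).norm_sq, by linarith [hinner r hrst]⟩)
  rw [intervalIntegral.integral_const_mul] at hle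
  linarith

theorem norm_sub_le_of_forall_inner_nonpos (hγ : IsCaratheodorySolution K X T γ) (hs : 0 ≤ s)
    (hst : s ≤ t) (ht : (t : EReal) < T) (hinner : ∀ r ∈ Ioo s t, ⟪γ r - w, X (γ r)⟫_ℝ ≤ 0) :
    ‖γ t - w‖ ≤ ‖γ s - w‖ := by
  have hle := hγ.norm_sub_sq_add_integral_le (φ := 0) hs hst ht intervalIntegrable_const
    (by simpa using hinner)
  simp only [Pi.zero_apply, intervalIntegral.integral_zero, mul_zero, add_zero] at hle
  exact le_of_sq_le_sq hle (norm_nonneg _)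

theorem norm_sub_le (hγ : IsCaratheodorySolution K X T γ) (hw : IsDissipativeAbout K X w)
    (hs : 0 ≤ s) (hst : s ≤ t) (ht : (t : EReal) < T) : ‖γ t - w‖ ≤ ‖γ s - w‖ :=
  hγ.norm_sub_le_of_forall_inner_nonpos hs hst ht fun _ hr =>
    hw _ (hγ.mapsTo_Icc ht ⟨hs.trans hr.1.le, hr.2.le⟩)

theorem mem_ball_of_isDissipativeAbout_inter_ball (hγ : IsCaratheodorySolution K X T γ) {R : ℝ}
    (hw : IsDissipativeAbout (K ∩ Metric.ball w R) X w) (h₀ : γ 0 ∈ Metric.ball w R)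
    (ht₀ : 0 ≤ t) (ht : (t : EReal) < T) : γ t ∈ Metric.ball w R := by
  by_contra htR
  have hcompact : IsCompact (Icc 0 t ∩ γ ⁻¹' (Metric.ball w R)ᶜ) :=
    isCompact_Icc.of_isClosed_subset ((hγ.continuousOn_Icc ht₀ ht).preimage_isClosed_of_isClosed
      isClosed_Icc Metric.isOpen_ball.isClosed_compl) inter_subset_left
  obtain ⟨exitTime, ⟨hexit, hexit_notMem⟩, hleast⟩ :=
    hcompact.exists_isLeast ⟨t, right_mem_Icc.2 ht₀, htR⟩
  have hexit_lt : (exitTime : EReal) < T := (EReal.coe_le_coe_iff.2 hexit.2).trans_lt ht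
  have hle := hγ.norm_sub_le_of_forall_inner_nonpos le_rfl hexit.1 hexit_lt fun r hr =>
    hw _ ⟨hγ.mapsTo_Icc hexit_lt (Ioo_subset_Icc_self hr), by
      by_contra hrR
      exact (hleast ⟨⟨hr.1.le, hr.2.le.trans hexit.2⟩, hrR⟩).not_gt hr.2⟩
  rw [← dist_eq_norm, ← dist_eq_norm] at hle
  exact hexit_notMem (hle.trans_lt h₀)

theorem congr_field {Y : E → E} (hγ : IsCaratheodorySolution K X T γ)
    (hXY : ∀ t : ℝ, 0 ≤ t → (t : EReal) < T → X (γ t) = Y (γ t)) :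
    IsCaratheodorySolution K Y T γ where
  pos := hγ.pos
  mem := hγ.mem
  absCont := hγ.absCont
  ode := by
    filter_upwards [hγ.ode] with t ht ht₀ htT
    exact hXY t ht₀ htT ▸ ht ht₀ htT

theorem eq_of_isOneSidedLipschitzOn
    (hX : ∀ B, IsCompact B → ∃ C, IsOneSidedLipschitzOn C X (K ∩ B))
    (hγ : IsCaratheodorySolution K X T γ) (hη : IsCaratheodorySolution K X T' η)
    (h₀ : γ 0 = η 0) (ht₀ : 0 ≤ t) (ht : (t : EReal) < T) (ht' : (t : EReal) < T') :
    γ t = η t := by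
  obtain ⟨C, hC⟩ := hX (γ '' Icc 0 t ∪ η '' Icc 0 t)
    ((isCompact_Icc.image_of_continuousOn (hγ.continuousOn_Icc ht₀ ht)).union
      (isCompact_Icc.image_of_continuousOn (hη.continuousOn_Icc ht₀ ht')))
  have hsq : LocallyLipschitz fun z : E => ‖z‖ ^ 2 := (contDiff_id.norm_sq ℝ).locallyLipschitz
  have hle := le_mul_exp_of_ae_hasDerivAt (C := 2 * C) ht₀
    (absolutelyContinuousOnInterval_comp hsq ((hγ.absCont t ht₀ ht).sub (hη.absCont t ht₀ ht')))
    (h' := fun r => 2 * ⟪γ r - η r, X (γ r) - X (η r)⟫_ℝ) (by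
      filter_upwards [hγ.ae_hasDerivAt le_rfl ht, hη.ae_hasDerivAt le_rfl ht'] with r hr hr' hrt
      have hrt' := Ioo_subset_Icc_self hrt
      refine ⟨((hr hrt).sub (hr' hrt)).norm_sq, ?_⟩
      have := hC _ ⟨hγ.mapsTo_Icc ht hrt', Or.inl (mem_image_of_mem γ hrt')⟩
        _ ⟨hη.mapsTo_Icc ht' hrt', Or.inr (mem_image_of_mem η hrt')⟩
      simp only [Pi.sub_apply]
      linarith)
  simpa [h₀, sub_eq_zero] using hle

theorem lipschitzOnWith_Ici (hγ : IsCaratheodorySolution K X ⊤ γ) {M : ℝ≥0}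
    (hM : ∀ t, 0 ≤ t → ‖X (γ t)‖ ≤ M) : LipschitzOnWith M γ (Ici 0) := by
  refine LipschitzOnWith.of_dist_le_mul fun s hs t ht => ?_
  wlog hts : t ≤ s generalizing s t
  · simpa only [dist_comm] using this t ht s hs (le_of_not_ge hts)
  rw [dist_eq_norm, Real.dist_eq, abs_of_nonneg (sub_nonneg.2 hts)]
  refine norm_sub_le_of_ae_hasDerivAt hts
    (hγ.absCont_of_nonneg ht hts (EReal.coe_lt_top s)) (γ' := fun r => X (γ r)) ?_
  filter_upwards [hγ.ae_hasDerivAt ht (EReal.coe_lt_top s)] with r hr hrts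
  exact ⟨hr hrts, hM r (le_trans ht hrts.1.le)⟩

theorem mem_closedBall (hγ : IsCaratheodorySolution K X ⊤ γ) (hw : IsDissipativeAbout K X w)
    (ht : 0 ≤ t) : γ t ∈ Metric.closedBall w ‖γ 0 - w‖ :=
  mem_closedBall_iff_norm.2 (hγ.norm_sub_le hw le_rfl ht (EReal.coe_lt_top t))

theorem uniformContinuousOn_comp [ProperSpace E] (hγ : IsCaratheodorySolution K X ⊤ γ)
    (hw : IsDissipativeAbout K X w) {b : E → ℝ} (hb : Continuous b) (hXb : ∀ z ∈ K, ‖X z‖ ≤ b z)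
    {F : Type*} [UniformSpace F] {ψ : E → F} (hψ : Continuous ψ) :
    UniformContinuousOn (fun t => ψ (γ t)) (Ici 0) := by
  have hball : IsCompact (Metric.closedBall w ‖γ 0 - w‖) := isCompact_closedBall _ _
  obtain ⟨M, hM⟩ := hball.bddAbove_image hb.continuousOn
  have hspeed : ∀ t, 0 ≤ t → ‖X (γ t)‖ ≤ M.toNNReal := fun t ht =>
    (hXb _ (hγ.mem t ht (EReal.coe_lt_top t))).trans <|
      (hM (mem_image_of_mem b (hγ.mem_closedBall hw ht))).trans (Real.le_coe_toNNReal M)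
  exact (hball.uniformContinuousOn_of_continuous hψ.continuousOn).comp
    (hγ.lipschitzOnWith_Ici hspeed).uniformContinuousOn fun t ht => hγ.mem_closedBall hw ht

theorem tendsto_comp_zero_of_inner_le_neg (hγ : IsCaratheodorySolution K X ⊤ γ) {W : E → ℝ}
    (hW₀ : ∀ z ∈ K, 0 ≤ W z) (hXW : ∀ z ∈ K, ⟪z - w, X z⟫_ℝ ≤ -W z)
    (hWγ : UniformContinuousOn (fun t => W (γ t)) (Ici 0)) :
    Tendsto (fun t => W (γ t)) atTop (𝓝 0) := by
  have hint : IntegrableOn (fun t => W (γ t)) (Ioi 0) := by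
    refine integrableOn_Ioi_of_intervalIntegral_norm_bounded (l := atTop) (b := id)
      (‖γ 0 - w‖ ^ 2 / 2) 0 (fun t => ?_) tendsto_id ?_
    · exact (hWγ.continuousOn.mono Icc_subset_Ici_self).integrableOn_Icc.mono_set
        Ioc_subset_Icc_self
    · filter_upwards [eventually_ge_atTop 0] with t ht
      have hnorm : ∫ s in (0 : ℝ)..t, ‖W (γ s)‖ = ∫ s in (0 : ℝ)..t, W (γ s) := by
        refine intervalIntegral.integral_congr fun s hs => ?_
        rw [uIcc_of_le ht] at hs
        exact Real.norm_of_nonneg (hW₀ _ (hγ.mapsTo_Icc (EReal.coe_lt_top t) hs))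
      rw [id, hnorm]
      linarith [hγ.norm_sub_sq_add_integral_le le_rfl ht (EReal.coe_lt_top t)
        (hWγ.continuousOn.mono (ordConnected_Ici.uIcc_subset self_mem_Ici ht)).intervalIntegrable
        fun s hs => hXW _ (hγ.mem s hs.1.le (EReal.coe_lt_top s)), sq_nonneg ‖γ t - w‖]
  exact tendsto_zero_of_tendsto_integral hWγ
    (intervalIntegral_tendsto_integral_Ioi 0 hint tendsto_id)

theorem tendsto_map_velocity_zero {F : Type*} [NormedAddCommGroup F] [NormedSpace ℝ F]
    [CompleteSpace F] (hγ : IsCaratheodorySolution K X ⊤ γ) (ℓ : E →L[ℝ] F)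
    (hℓX : UniformContinuousOn (fun t => ℓ (X (γ t))) (Ici 0)) {a : F}
    (ha : Tendsto (fun t => ℓ (γ t)) atTop (𝓝 a)) :
    Tendsto (fun t => ℓ (X (γ t))) atTop (𝓝 0) := by
  refine tendsto_zero_of_tendsto_integral hℓX (a := a - ℓ (γ 0)) ((ha.sub_const _).congr' ?_)
  filter_upwards [eventually_ge_atTop 0] with t ht
  refine sub_eq_integral_of_ae_hasDerivAt ht
    (absolutelyContinuousOnInterval_comp ℓ.lipschitz.locallyLipschitz
      (hγ.absCont t ht (EReal.coe_lt_top t))) ?_ ?_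
  · exact (hℓX.continuousOn.mono (ordConnected_Ici.uIcc_subset self_mem_Ici ht)).intervalIntegrable
  · filter_upwards [hγ.ae_hasDerivAt le_rfl (EReal.coe_lt_top t)] with s hs hst
    exact ℓ.hasFDerivAt.comp_hasDerivAt s (hs hst)

theorem tendsto_of_mapClusterPt (hγ : IsCaratheodorySolution K X ⊤ γ)
    (hw : IsDissipativeAbout K X w) (hcluster : MapClusterPt w atTop γ) :
    Tendsto γ atTop (𝓝 w) := by
  rw [Metric.tendsto_atTop]
  intro ε hε
  obtain ⟨s, hs, hs₀⟩ := ((hcluster.frequently (Metric.ball_mem_nhds w hε)).and_eventually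
    (eventually_ge_atTop 0)).exists
  refine ⟨s, fun t ht => lt_of_le_of_lt ?_ (Metric.mem_ball.1 hs)⟩
  rw [dist_eq_norm, dist_eq_norm]
  exact hγ.norm_sub_le hw hs₀ ht (EReal.coe_lt_top t)

end IsCaratheodorySolution

theorem isGloballyAsymptoticallyStableOn_of_isDissipativeAbout (hSK : S ⊆ K)
    (hdiss : ∀ w ∈ S, IsDissipativeAbout K X w)
    (hX : ∀ B, IsCompact B → ∃ C, IsOneSidedLipschitzOn C X (K ∩ B))
    (hexists : ∀ z ∈ K, ∃ γ : ℝ → E, IsCaratheodorySolution K X ⊤ γ ∧ γ 0 = z)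
    (hconv : ∀ γ : ℝ → E, IsCaratheodorySolution K X ⊤ γ → ∃ z ∈ S, Tendsto γ atTop (𝓝 z)) :
    IsGloballyAsymptoticallyStableOn K X S where
  subset := hSK
  exists_solution := hexists
  extends_solution T γ hγ := by
    obtain ⟨η, hη, hη₀⟩ := hexists (γ 0) (hγ.mem 0 le_rfl hγ.pos)
    exact ⟨η, hη, fun t ht₀ ht =>
      IsCaratheodorySolution.eq_of_isOneSidedLipschitzOn hX hη hγ hη₀ ht₀ (EReal.coe_lt_top t) ht⟩
  stable ε hε := by
    refine ⟨ε, hε, fun T γ hγ h₀ t ht₀ ht => ?_⟩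
    obtain ⟨w, hw, hdist⟩ := Metric.mem_thickening_iff.1 h₀
    refine Metric.mem_thickening_iff.2 ⟨w, hw, lt_of_le_of_lt ?_ hdist⟩
    rw [dist_eq_norm, dist_eq_norm]
    exact hγ.norm_sub_le (hdiss w hw) le_rfl ht₀ ht
  attractive γ hγ ε hε := by
    obtain ⟨z, hz, hlim⟩ := hconv γ hγ
    exact hlim.eventually
      (Metric.isOpen_thickening.mem_nhds (Metric.self_subset_thickening hε S hz))

end CaratheodorySolutions

section OrthantDynamics

open scoped NNReal InnerProductSpace

variable {E ι : Type*} [NormedAddCommGroup E] [InnerProductSpace ℝ E] [Fintype ι] {e : ι → E}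
  {A : E → E}

theorem isOneSidedLipschitzOn_projectVelocity {B : Set E} {C : ℝ≥0} (hA : LipschitzOnWith C A B) :
    IsOneSidedLipschitzOn C (fun z => projectVelocity e (A z) z) (orthant e ∩ B) := by
  rintro z ⟨hz, hzB⟩ w ⟨hw, hwB⟩
  have hle : ⟪z - w, A w⟫_ℝ ≤ ⟪z - w, projectVelocity e (A w) w⟫_ℝ := by
    simpa only [← neg_sub z w, inner_neg_left, neg_le_neg_iff] using
      inner_sub_projectVelocity_le hw hz (A w)
  calc ⟪z - w, projectVelocity e (A z) z - projectVelocity e (A w) w⟫_ℝ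
      = ⟪z - w, projectVelocity e (A z) z⟫_ℝ - ⟪z - w, projectVelocity e (A w) w⟫_ℝ :=
        inner_sub_right _ _ _
    _ ≤ ⟪z - w, A z⟫_ℝ - ⟪z - w, A w⟫_ℝ := sub_le_sub (inner_sub_projectVelocity_le hz hw _) hle
    _ = ⟪z - w, A z - A w⟫_ℝ := (inner_sub_right _ _ _).symm
    _ ≤ ‖z - w‖ * ‖A z - A w‖ := real_inner_le_norm _ _
    _ ≤ ‖z - w‖ * (C * ‖z - w‖) :=
        mul_le_mul_of_nonneg_left (hA.norm_sub_le hzB hwB) (norm_nonneg _)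
    _ = C * ‖z - w‖ ^ 2 := by ring

theorem exists_isOneSidedLipschitzOn_projectVelocity (hA : LocallyLipschitz A) {B : Set E}
    (hB : IsCompact B) :
    ∃ C, IsOneSidedLipschitzOn C (fun z => projectVelocity e (A z) z) (orthant e ∩ B) :=
  (hA.locallyLipschitzOn.exists_lipschitzOnWith_of_compact hB).elim fun C hC =>
    ⟨C, isOneSidedLipschitzOn_projectVelocity hC⟩

theorem exists_isCaratheodorySolution_of_locallyLipschitz [FiniteDimensional ℝ E]
    (he : Orthonormal ℝ e) (hA : LocallyLipschitz A) {w z₀ : E}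
    (hw : IsDissipativeAbout (orthant e) (fun z => projectVelocity e (A z) z) w)
    (hz₀ : z₀ ∈ orthant e) :
    ∃ γ : ℝ → E, IsCaratheodorySolution (orthant e) (fun z => projectVelocity e (A z) z) ⊤ γ ∧
      γ 0 = z₀ := by
  have := FiniteDimensional.proper_real E
  have := FiniteDimensional.complete ℝ E
  let R := dist z₀ w + 1
  obtain ⟨C, hC⟩ := hA.locallyLipschitzOn.exists_lipschitzOnWith_of_compact
    (isCompact_closedBall w R)
  obtain ⟨A', hA', hAA'⟩ := hC.extend_finite_dimension
  replace hAA' := hAA'.mono Metric.ball_subset_closedBall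
  obtain ⟨γ, hγ, hγ₀⟩ := exists_isCaratheodorySolution_of_lipschitzWith he hA' hz₀
  have hdiss : IsDissipativeAbout (orthant e ∩ Metric.ball w R)
      (fun z => projectVelocity e (A' z) z) w := fun z hz => by
    simpa only [hAA' hz.2] using hw z hz.1
  refine ⟨γ, hγ.congr_field fun t ht₀ ht => ?_, hγ₀⟩
  rw [hAA' (hγ.mem_ball_of_isDissipativeAbout_inter_ball hdiss ?_ ht₀ ht)]
  exact hγ₀ ▸ lt_add_one (dist z₀ w)

end OrthantDynamics

section ClusterPoints

variable {α X Y : Type*} [TopologicalSpace X] [TopologicalSpace Y] [T2Space Y] {l : Filter α}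
  {γ : α → X} {ψ : X → Y} {c : Y}

theorem eq_of_mapClusterPt_of_tendsto_comp {x : X} (hx : MapClusterPt x l γ)
    (hψ : ContinuousAt ψ x) (hc : Tendsto (fun t => ψ (γ t)) l (𝓝 c)) : ψ x = c := by
  have : ClusterPt (ψ x) (𝓝 c) := (hx.continuousAt_comp hψ).clusterPt.mono hc
  exact eq_of_nhds_neBot this

theorem tendsto_of_tendsto_comp {B : Set X} (hB : IsCompact B) (hγ : ∀ᶠ t in l, γ t ∈ B)
    (hψ : Continuous ψ) (hc : Tendsto (fun t => ψ (γ t)) l (𝓝 c)) {a : X}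
    (ha : ∀ x ∈ B, ψ x = c → x = a) : Tendsto γ l (𝓝 a) :=
  hB.tendsto_nhds_of_unique_mapClusterPt hγ fun x hx hcluster =>
    ha x hx (eq_of_mapClusterPt_of_tendsto_comp hcluster hψ.continuousAt hc)

end ClusterPoints

section GradientInequality

open scoped InnerProductSpace

variable {E : Type*} [NormedAddCommGroup E] [InnerProductSpace ℝ E] [CompleteSpace E]
  {s : Set E} {f : E → ℝ} {x y : E}

theorem add_inner_gradient_le_of_convexOn (hf : ConvexOn ℝ s f) (hx : x ∈ s) (hy : y ∈ s)
    (hfx : DifferentiableAt ℝ f x) : f x + ⟪gradient f x, y - x⟫_ℝ ≤ f y := by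
  let line : ℝ →ᵃ[ℝ] E := AffineMap.lineMap x y
  have hderiv : HasDerivAt (f ∘ line) ⟪gradient f x, y - x⟫_ℝ 0 := by
    rw [inner_gradient_left]
    exact HasFDerivAt.comp_hasDerivAt 0 (by simpa [line] using hfx.hasFDerivAt)
      AffineMap.hasDerivAt_lineMap
  have hslope := (hf.comp_affineMap line).le_slope_of_hasDerivAt (x := 0) (y := 1)
    (by simpa [line] using hx) (by simpa [line] using hy) zero_lt_one hderiv
  simp only [slope_def_field, Function.comp_apply, line, AffineMap.lineMap_apply_one,
    AffineMap.lineMap_apply_zero, sub_zero, div_one] at hslope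
  linarith

theorem le_add_inner_gradient_of_concaveOn (hf : ConcaveOn ℝ s f) (hx : x ∈ s) (hy : y ∈ s)
    (hfx : DifferentiableAt ℝ f x) : f y ≤ f x + ⟪gradient f x, y - x⟫_ℝ := by
  have hneg := add_inner_gradient_le_of_convexOn hf.neg hx hy hfx.neg
  rw [inner_gradient_left, fderiv_neg] at hneg
  simp only [Pi.neg_apply, neg_apply, ← inner_gradient_left] at hneg
  linarith

theorem sub_sum_mul_le_add_inner_gradient {ι : Type*} [Fintype ι] {G : ι → E → ℝ} {lam : ι → ℝ}
    (hf : ConcaveOn ℝ s f) (hG : ∀ i, ConvexOn ℝ s (G i)) (hlam : 0 ≤ lam) (hx : x ∈ s)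
    (hy : y ∈ s) (hfx : DifferentiableAt ℝ f x) (hGx : ∀ i, DifferentiableAt ℝ (G i) x) :
    f y - ∑ i, lam i * G i y ≤ f x - ∑ i, lam i * G i x +
      ⟪gradient f x - ∑ i, lam i • gradient (G i) x, y - x⟫_ℝ := by
  have hobjective := le_add_inner_gradient_of_concaveOn hf hx hy hfx
  have hconstraints : ∑ i, lam i * (G i x + ⟪gradient (G i) x, y - x⟫_ℝ) ≤ ∑ i, lam i * G i y :=
    Finset.sum_le_sum fun i _ => mul_le_mul_of_nonneg_left
      (add_inner_gradient_le_of_convexOn (hG i) hx hy (hGx i)) (hlam i)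
  simp only [mul_add, Finset.sum_add_distrib] at hconstraints
  simp only [inner_sub_left, sum_inner, real_inner_smul_left]
  linarith

end GradientInequality

section TheoremOfAlternative

theorem nonneg_of_forall_le_sum_mul_nonneg {J : Type*} [Fintype J] {p u : J → ℝ}
    (h : ∀ y, u ≤ y → 0 ≤ ∑ j, p j * y j) : 0 ≤ p := by
  classical
  intro j
  by_contra! hlt : p j < 0
  have hu := h u le_rfl
  have ht : 0 ≤ (∑ k, p k * u k + 1) / -p j := div_nonneg (by linarith) (neg_nonneg.2 hlt.le)
  have hray := h (u + Pi.single j ((∑ k, p k * u k + 1) / -p j))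
    (le_add_of_nonneg_right (Pi.single_nonneg.2 ht))
  simp only [Pi.add_apply, mul_add, Finset.sum_add_distrib, Pi.single_apply, mul_ite, mul_zero,
    Finset.sum_ite_eq', Finset.mem_univ, if_true] at hray
  have hcancel : p j * ((∑ k, p k * u k + 1) / -p j) = -(∑ k, p k * u k + 1) := by
    have : p j ≠ 0 := hlt.ne
    field_simp
  linarith

theorem isOpen_setOf_exists_forall_lt {X J : Type*} [Finite J] (s : Set X) (F : J → X → ℝ) :
    IsOpen {y : J → ℝ | ∃ x ∈ s, ∀ j, F j x < y j} := by
  have hunion : {y : J → ℝ | ∃ x ∈ s, ∀ j, F j x < y j} =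
      ⋃ x ∈ s, univ.pi fun j => Ioi (F j x) := by
    ext y
    simp
  rw [hunion]
  exact isOpen_biUnion fun x _ => isOpen_set_pi finite_univ fun j _ => isOpen_Ioi

variable {X : Type*} [AddCommGroup X] [Module ℝ X] {s : Set X}

theorem convex_setOf_exists_forall_lt {J : Type*} [Nonempty J] {F : J → X → ℝ}
    (hF : ∀ j, ConvexOn ℝ s (F j)) : Convex ℝ {y : J → ℝ | ∃ x ∈ s, ∀ j, F j x < y j} := by
  rintro y ⟨x, hx, hxy⟩ y' ⟨x', hx', hxy'⟩ a b ha hb hab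
  have hepi : ∀ j, a • x + b • x' ∈ s ∧ F j (a • x + b • x') < a * y j + b * y' j := fun j =>
    (hF j).convex_strict_epigraph (x := (x, y j)) ⟨hx, hxy j⟩ (y := (x', y' j)) ⟨hx', hxy' j⟩
      ha hb hab
  exact ⟨_, (hepi (Classical.arbitrary J)).1, fun j => (hepi j).2⟩

/-- The theorem of the alternative of Fan, Glicksberg and Hoffman. -/
theorem exists_sum_mul_nonneg_of_forall_exists_nonneg {J : Type*} [Fintype J] {F : J → X → ℝ}
    (hs : s.Nonempty) (hF : ∀ j, ConvexOn ℝ s (F j)) (h : ∀ x ∈ s, ∃ j, 0 ≤ F j x) :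
    ∃ p : J → ℝ, 0 ≤ p ∧ p ≠ 0 ∧ ∀ x ∈ s, 0 ≤ ∑ j, p j * F j x := by
  classical
  obtain ⟨x₀, hx₀⟩ := hs
  have : Nonempty J := (h x₀ hx₀).nonempty
  obtain ⟨φ, hφ⟩ := geometric_hahn_banach_point_open (convex_setOf_exists_forall_lt hF)
    (isOpen_setOf_exists_forall_lt s F) (x := (0 : J → ℝ)) fun ⟨x, hx, hneg⟩ => by
      obtain ⟨j, hj⟩ := h x hx
      exact (hneg j).not_ge hj
  rw [map_zero] at hφ
  obtain ⟨p, hp⟩ : ∃ p : J → ℝ, ∀ y, φ y = ∑ j, p j * y j :=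
    ⟨fun j => φ fun k => if j = k then 1 else 0, fun y => by
      simpa [mul_comm] using LinearMap.pi_apply_eq_sum_univ (φ : (J → ℝ) →ₗ[ℝ] ℝ) y⟩
  have hφ_nonneg : ∀ x ∈ s, ∀ y : J → ℝ, (∀ j, F j x ≤ y j) → 0 ≤ ∑ j, p j * y j := by
    intro x hx y hxy
    have hclosure : y ∈ closure (univ.pi fun j => Ioi (F j x)) := by
      simpa [closure_pi_set, Pi.le_def] using hxy
    have hsubset : (univ.pi fun j => Ioi (F j x)) ⊆ φ ⁻¹' Ici 0 := fun z hz =>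
      (hφ z ⟨x, hx, fun j => hz j (mem_univ j)⟩).le
    rw [← hp]
    exact closure_minimal hsubset (isClosed_Ici.preimage φ.continuous) hclosure
  refine ⟨p, ?_, ?_, fun x hx => hφ_nonneg x hx _ fun j => le_rfl⟩
  · exact nonneg_of_forall_le_sum_mul_nonneg (hφ_nonneg x₀ hx₀)
  · rintro rfl
    have hpos := hφ (fun j => F j x₀ + 1) ⟨x₀, hx₀, fun j => lt_add_one _⟩
    simp [hp] at hpos

/-- Fritz John multipliers are Karush–Kuhn–Tucker multipliers under Slater's condition. -/
theorem exists_lagrange_multiplier {ι : Type*} [Fintype ι] {F : X → ℝ} {G : ι → X → ℝ}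
    (hF : ConvexOn ℝ s F) (hG : ∀ i, ConvexOn ℝ s (G i)) (h_slater : ∃ x ∈ s, ∀ i, G i x < 0)
    (h : ∀ x ∈ s, (∀ i, G i x < 0) → 0 ≤ F x) :
    ∃ lam : ι → ℝ, 0 ≤ lam ∧ ∀ x ∈ s, 0 ≤ F x + ∑ i, lam i * G i x := by
  obtain ⟨x₀, hx₀, hneg⟩ := h_slater
  obtain ⟨p, hp, hp_ne, hsum⟩ := exists_sum_mul_nonneg_of_forall_exists_nonneg
    (F := fun j : Option ι => j.elim F G) ⟨x₀, hx₀⟩ (Option.forall.2 ⟨hF, hG⟩) fun x hx => by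
      by_contra! hlt
      exact (hlt none).not_ge (h x hx fun i => hlt (some i))
  simp only [Fintype.sum_option, Option.elim] at hsum
  have hp_none : 0 < p none := by
    refine (hp none).lt_of_ne' fun hzero => hp_ne ?_
    have hterm : ∀ i ∈ Finset.univ, p (some i) * G i x₀ ≤ 0 := fun i _ =>
      mul_nonpos_of_nonneg_of_nonpos (hp (some i)) (hneg i).le
    have hterm_eq := (Finset.sum_eq_zero_iff_of_nonpos hterm).1
      ((Finset.sum_nonpos hterm).antisymm (by simpa [hzero] using hsum x₀ hx₀))
    exact funext <| Option.forall.2 ⟨hzero, fun i =>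
      (mul_eq_zero.1 (hterm_eq i (Finset.mem_univ i))).resolve_right (hneg i).ne⟩
  refine ⟨fun i => p (some i) / p none, fun i => div_nonneg (hp _) hp_none.le, fun x hx => ?_⟩
  calc 0 ≤ (p none * F x + ∑ i, p (some i) * G i x) / p none := div_nonneg (hsum x hx) hp_none.le
    _ = F x + ∑ i, p (some i) / p none * G i x := by
      rw [add_div, mul_div_cancel_left₀ _ hp_none.ne', Finset.sum_div]
      simp only [div_mul_eq_mul_div]

end TheoremOfAlternative

section Duality

variable {n m : ℕ} {f : EuclideanSpace ℝ (Fin n) → ℝ}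
  {g : EuclideanSpace ℝ (Fin n) → EuclideanSpace ℝ (Fin m)}

theorem le_lagrangian_of_feasible {x : EuclideanSpace ℝ (Fin n)} (hx : ∀ i, g x i ≤ 0)
    {lam : EuclideanSpace ℝ (Fin m)} (hlam : ∀ i, 0 ≤ lam i) : f x ≤ lagrangian f g x lam :=
  le_sub_self_iff _ |>.2 <|
    Finset.sum_nonpos fun i _ => mul_nonpos_of_nonneg_of_nonpos (hlam i) (hx i)

theorem strictConcaveOn_lagrangian (hf : StrictConcaveOn ℝ univ f)
    (hg : ∀ i, ConvexOn ℝ univ fun x => g x i) {lam : EuclideanSpace ℝ (Fin m)}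
    (hlam : ∀ i, 0 ≤ lam i) : StrictConcaveOn ℝ univ fun x => lagrangian f g x lam := by
  have hpenalty : ConvexOn ℝ univ fun x => ∑ i, lam i * g x i := by
    rw [← Finset.sum_fn]
    exact Finset.sum_induction _ (ConvexOn ℝ univ) (fun _ _ => ConvexOn.add)
      (convexOn_const 0 convex_univ) fun i _ => (hg i).smul (hlam i)
  exact hf.sub_convexOn hpenalty

theorem IsPrimalOptimizer.exists_multiplier (hf : ConcaveOn ℝ univ f)
    (hg : ∀ i, ConvexOn ℝ univ fun x => g x i) (h_slater : ∃ x, ∀ i, g x i < 0)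
    {x : EuclideanSpace ℝ (Fin n)} (hx : IsPrimalOptimizer f g x) :
    ∃ lam : EuclideanSpace ℝ (Fin m), (∀ i, 0 ≤ lam i) ∧ ∀ y, lagrangian f g y lam ≤ f x := by
  obtain ⟨lam, hlam, hle⟩ := exists_lagrange_multiplier ((convexOn_const (f x) convex_univ).sub hf)
    hg (by simpa using h_slater) fun y _ hy => sub_nonneg.2 (hx.2 y fun i => (hy i).le)
  refine ⟨WithLp.toLp 2 lam, hlam, fun y => ?_⟩
  have hy : 0 ≤ f x - f y + ∑ i, lam i * g y i := hle y (mem_univ y)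
  rw [lagrangian]
  linarith

theorem mem_saddlePoints_of_le {x : EuclideanSpace ℝ (Fin n)} {lam : EuclideanSpace ℝ (Fin m)}
    (hx : ∀ i, g x i ≤ 0) (hlam : ∀ i, 0 ≤ lam i) (h : ∀ y, lagrangian f g y lam ≤ f x) :
    (WithLp.toLp 2 (x, lam) : State n m) ∈ saddlePoints f g :=
  ⟨hlam, fun y => (h y).trans (le_lagrangian_of_feasible hx hlam), fun _ hmu =>
    (h x).trans (le_lagrangian_of_feasible hx hmu)⟩

theorem feasible_of_mem_saddlePoints {z : State n m} (hz : z ∈ saddlePoints f g) (i : Fin m) :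
    g z.fst i ≤ 0 := by
  obtain ⟨hdom, -, hmin⟩ := hz
  have hsingle : ∀ j, (0 : ℝ) ≤ EuclideanSpace.single i (1 : ℝ) j := fun j => by
    rw [PiLp.single_apply]
    split_ifs <;> norm_num
  have hbump := hmin (z.snd + EuclideanSpace.single i 1) fun j =>
    add_nonneg (hdom j) (hsingle j)
  simp only [lagrangian, PiLp.add_apply, PiLp.single_apply, add_mul,
    Finset.sum_add_distrib, ite_mul, one_mul, zero_mul, Finset.sum_ite_eq',
    Finset.mem_univ, if_true] at hbump
  linarith

theorem lagrangian_le_of_mem_saddlePoints {z : State n m} (hz : z ∈ saddlePoints f g) :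
    lagrangian f g z.fst z.snd ≤ f z.fst := by
  simpa [lagrangian] using hz.2.2 0 fun _ => le_rfl

theorem saddlePoints_subset_primalDualOptimizers :
    saddlePoints f g ⊆ primalDualOptimizers f g := by
  intro z hz
  have hle := lagrangian_le_of_mem_saddlePoints hz
  have hfeas := feasible_of_mem_saddlePoints hz
  obtain ⟨hdom, hmax, hmin⟩ := hz
  refine ⟨⟨hfeas, fun y hy => ?_⟩, hdom, fun mu hmu => ?_⟩
  · exact (le_lagrangian_of_feasible hy hdom).trans ((hmax y).trans hle)
  · exact (iSup_le fun y => EReal.coe_le_coe_iff.2 ((hmax y).trans (hmin mu hmu))).trans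
      (le_iSup (fun y => (lagrangian f g y mu : EReal)) z.fst)

theorem primalDualOptimizers_eq_saddlePoints (hf : ConcaveOn ℝ univ f)
    (hg : ∀ i, ConvexOn ℝ univ fun x => g x i) (h_slater : ∃ x, ∀ i, g x i < 0) :
    primalDualOptimizers f g = saddlePoints f g := by
  refine Subset.antisymm ?_ saddlePoints_subset_primalDualOptimizers
  rintro z ⟨hx, hlam, hdual⟩
  obtain ⟨mu, hmu, hle⟩ := hx.exists_multiplier hf hg h_slater
  have hstrong : dualFunction f g z.snd ≤ f z.fst :=
    (hdual mu hmu).trans (iSup_le fun y => EReal.coe_le_coe_iff.2 (hle y))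
  exact mem_saddlePoints_of_le hx.1 hlam fun y => EReal.coe_le_coe_iff.1 <|
    (le_iSup (fun y => (lagrangian f g y z.snd : EReal)) y).trans hstrong

theorem saddlePoints_nonempty (hf : ConcaveOn ℝ univ f)
    (hg : ∀ i, ConvexOn ℝ univ fun x => g x i) (h_slater : ∃ x, ∀ i, g x i < 0)
    (h_opt : ∃ x, IsPrimalOptimizer f g x) : (saddlePoints f g).Nonempty := by
  obtain ⟨x, hx⟩ := h_opt
  obtain ⟨lam, hlam, hle⟩ := hx.exists_multiplier hf hg h_slater
  exact ⟨_, mem_saddlePoints_of_le hx.1 hlam hle⟩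

end Duality

section SaddleField

open scoped InnerProductSpace

variable {n m : ℕ} {f : EuclideanSpace ℝ (Fin n) → ℝ}
  {g : EuclideanSpace ℝ (Fin n) → EuclideanSpace ℝ (Fin m)}

/-- The vector field `(∇ₓL, -∇_λ L)` of the saddle-point dynamics without the constraint `λ ≥ 0`. -/
noncomputable def saddleField (f : EuclideanSpace ℝ (Fin n) → ℝ)
    (g : EuclideanSpace ℝ (Fin n) → EuclideanSpace ℝ (Fin m)) (z : State n m) : State n m :=
  WithLp.toLp 2 (gradient f z.fst - ∑ i, z.snd i • gradient (fun y => g y i) z.fst, g z.fst)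

/-- The unit vector of the multiplier `λ i`; the orthant of these vectors is the domain of the
primal-dual dynamics. -/
noncomputable def multiplierAxis (i : Fin m) : State n m :=
  WithLp.toLp 2 (0, EuclideanSpace.single i 1)

theorem inner_multiplierAxis (i : Fin m) (z : State n m) : ⟪multiplierAxis i, z⟫_ℝ = z.snd i := by
  simp [multiplierAxis, WithLp.prod_inner_apply, EuclideanSpace.inner_single_left]

theorem orthonormal_multiplierAxis : Orthonormal ℝ (multiplierAxis : Fin m → State n m) := by
  rw [orthonormal_iff_ite]
  intro i j
  rw [inner_multiplierAxis, multiplierAxis, WithLp.toLp_snd, PiLp.single_apply]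

theorem sum_smul_multiplierAxis (c : Fin m → ℝ) :
    ∑ i, c i • multiplierAxis i = (WithLp.toLp 2 (0, WithLp.toLp 2 c) : State n m) := by
  refine WithLp.ofLp_injective 2 (Prod.ext ?_ ?_)
  · simp [multiplierAxis, Prod.fst_sum]
  · ext j
    simp [multiplierAxis, Prod.snd_sum, Pi.single_apply]

theorem orthant_multiplierAxis : orthant (multiplierAxis : Fin m → State n m) = domain n m := by
  simp only [orthant, domain, inner_multiplierAxis]

theorem projectVelocity_multiplierAxis_saddleField :
    (fun z => projectVelocity multiplierAxis (saddleField f g z) z) = primalDualField f g := by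
  funext z
  simp only [projectVelocity, sum_smul_multiplierAxis, inner_multiplierAxis]
  refine WithLp.ofLp_injective 2 (Prod.ext ?_ ?_)
  · simp [saddleField, primalDualField]
  · ext i
    simp [saddleField, primalDualField]

theorem locallyLipschitz_saddleField (hg : LocallyLipschitz g)
    (hf_lip : LocallyLipschitz (gradient f))
    (hg_lip : ∀ i, LocallyLipschitz (gradient fun x => g x i)) :
    LocallyLipschitz (saddleField f g) := by
  let split := WithLp.prodContinuousLinearEquiv 2 ℝ (EuclideanSpace ℝ (Fin n))
    (EuclideanSpace ℝ (Fin m))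
  have hfst : LocallyLipschitz fun z : State n m => z.fst :=
    ((ContinuousLinearMap.fst ℝ _ _).comp split.toContinuousLinearMap).lipschitz.locallyLipschitz
  have hsnd : ∀ i, LocallyLipschitz fun z : State n m => z.snd i := fun i =>
    ((EuclideanSpace.proj i).comp ((ContinuousLinearMap.snd ℝ _ _).comp
      split.toContinuousLinearMap)).lipschitz.locallyLipschitz
  have hterm : ∀ i, LocallyLipschitz fun z : State n m =>
      z.snd i • gradient (fun y => g y i) z.fst := fun i =>
    (contDiff_smul (𝕜 := ℝ) (n := 1)).locallyLipschitz.comp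
      ((hsnd i).prodMk ((hg_lip i).comp hfst))
  have hsum : LocallyLipschitz fun z : State n m =>
      ∑ i, z.snd i • gradient (fun y => g y i) z.fst := by
    rw [← Finset.sum_fn]
    exact Finset.sum_induction _ LocallyLipschitz (fun _ _ => LocallyLipschitz.add)
      (LocallyLipschitz.const 0) fun i _ => hterm i
  exact split.symm.lipschitz.locallyLipschitz.comp
    (((hf_lip.comp hfst).sub hsum).prodMk (hg.comp hfst))

section GradientInequality

variable (hf : Differentiable ℝ f) (hg : Differentiable ℝ g) (hf_concave : ConcaveOn ℝ univ f)
  (hg_convex : ∀ i, ConvexOn ℝ univ fun x => g x i)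
include hf hg hf_concave hg_convex

theorem lagrangian_le_add_inner {z : State n m} (hz : z ∈ domain n m)
    (y : EuclideanSpace ℝ (Fin n)) :
    lagrangian f g y z.snd ≤
      lagrangian f g z.fst z.snd + ⟪(saddleField f g z).fst, y - z.fst⟫_ℝ :=
  sub_sum_mul_le_add_inner_gradient hf_concave hg_convex hz (mem_univ _) (mem_univ _) (hf z.fst)
    fun i => differentiable_euclidean.1 hg i z.fst

theorem inner_sub_saddleField_le {z : State n m} (hz : z ∈ domain n m) (w : State n m) :
    ⟪z - w, saddleField f g z⟫_ℝ ≤ lagrangian f g z.fst w.snd - lagrangian f g w.fst z.snd := by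
  have hprimal := lagrangian_le_add_inner hf hg hf_concave hg_convex hz w.fst
  have hdual : ⟪z.snd - w.snd, (saddleField f g z).snd⟫_ℝ =
      lagrangian f g z.fst w.snd - lagrangian f g z.fst z.snd := by
    simp only [saddleField, WithLp.toLp_snd, PiLp.inner_apply, lagrangian, PiLp.sub_apply,
      RCLike.inner_apply, conj_trivial, sub_sub_sub_cancel_left, ← Finset.sum_sub_distrib]
    exact Finset.sum_congr rfl fun i _ => by ring
  rw [WithLp.prod_inner_apply]
  change ⟪z.fst - w.fst, (saddleField f g z).fst⟫_ℝ +
    ⟪z.snd - w.snd, (saddleField f g z).snd⟫_ℝ ≤ _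
  rw [hdual, ← neg_sub w.fst, inner_neg_left, real_inner_comm]
  linarith

end GradientInequality

end SaddleField

section Convergence

open scoped InnerProductSpace

variable {n m : ℕ} {f : EuclideanSpace ℝ (Fin n) → ℝ}
  {g : EuclideanSpace ℝ (Fin n) → EuclideanSpace ℝ (Fin m)} {w z : State n m}
  {γ : ℝ → State n m}

/-- The duality gap `L(w.fst, z.snd) - L(z.fst, w.snd)` of `z` relative to `w`; for a saddle point
`w` it bounds from below the rate at which the squared distance to `w` decreases. -/
noncomputable def relativeGap (f : EuclideanSpace ℝ (Fin n) → ℝ)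
    (g : EuclideanSpace ℝ (Fin n) → EuclideanSpace ℝ (Fin m)) (w z : State n m) : ℝ :=
  lagrangian f g w.fst z.snd - lagrangian f g z.fst w.snd

theorem continuous_relativeGap (hf : Continuous f) (hg : Continuous g) :
    Continuous (relativeGap f g w) := by
  unfold relativeGap lagrangian
  fun_prop

theorem sub_lagrangian_le_relativeGap (hw : w ∈ saddlePoints f g) (hz : z ∈ domain n m) :
    lagrangian f g w.fst w.snd - lagrangian f g z.fst w.snd ≤ relativeGap f g w z :=
  sub_le_sub_right (hw.2.2 z.snd hz) _

theorem relativeGap_nonneg (hw : w ∈ saddlePoints f g) (hz : z ∈ domain n m) :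
    0 ≤ relativeGap f g w z :=
  (sub_nonneg.2 (hw.2.1 z.fst)).trans (sub_lagrangian_le_relativeGap hw hz)

theorem mem_saddlePoints_of_relativeGap_eq_zero (hw : w ∈ saddlePoints f g) (hz : z ∈ domain n m)
    (hfst : z.fst = w.fst) (hgap : relativeGap f g w z = 0)
    (hmax : ∀ x, lagrangian f g x z.snd ≤ lagrangian f g z.fst z.snd) : z ∈ saddlePoints f g := by
  refine ⟨hz, hmax, fun lam hlam => ?_⟩
  rw [relativeGap, hfst, sub_eq_zero] at hgap
  rw [hfst, hgap]
  exact hw.2.2 lam hlam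

theorem norm_primalDualField_le (z : State n m) :
    ‖primalDualField f g z‖ ≤ ‖saddleField f g z‖ := by
  rw [← projectVelocity_multiplierAxis_saddleField]
  exact norm_projectVelocity_le orthonormal_multiplierAxis _ _

section Dissipativity

variable (hf : Differentiable ℝ f) (hg : Differentiable ℝ g) (hf_concave : ConcaveOn ℝ univ f)
  (hg_convex : ∀ i, ConvexOn ℝ univ fun x => g x i)
include hf hg hf_concave hg_convex

theorem inner_sub_primalDualField_le (hw : w ∈ domain n m) (hz : z ∈ domain n m) :
    ⟪z - w, primalDualField f g z⟫_ℝ ≤ -relativeGap f g w z := by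
  rw [← projectVelocity_multiplierAxis_saddleField, relativeGap, neg_sub]
  rw [← orthant_multiplierAxis] at hw
  exact (inner_sub_projectVelocity_le (orthant_multiplierAxis.symm ▸ hz) hw _).trans
    (inner_sub_saddleField_le hf hg hf_concave hg_convex hz w)

theorem isDissipativeAbout_of_mem_saddlePoints (hw : w ∈ saddlePoints f g) :
    IsDissipativeAbout (domain n m) (primalDualField f g) w := fun _ hz =>
  (inner_sub_primalDualField_le hf hg hf_concave hg_convex hw.1 hz).trans
    (neg_nonpos.2 (relativeGap_nonneg hw hz))

end Dissipativity

section Solutions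

variable (hf : Differentiable ℝ f) (hg : Differentiable ℝ g)
  (hg_convex : ∀ i, ConvexOn ℝ univ fun x => g x i) (hfield : Continuous (saddleField f g))
  (hw : w ∈ saddlePoints f g)
  (hγ : IsCaratheodorySolution (domain n m) (primalDualField f g) ⊤ γ)
include hf hg hg_convex hfield hw hγ

theorem tendsto_relativeGap_zero (hf_concave : ConcaveOn ℝ univ f) :
    Tendsto (fun t => relativeGap f g w (γ t)) atTop (𝓝 0) :=
  hγ.tendsto_comp_zero_of_inner_le_neg (fun _ => relativeGap_nonneg hw)
    (fun _ => inner_sub_primalDualField_le hf hg hf_concave hg_convex hw.1)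
    (hγ.uniformContinuousOn_comp
      (isDissipativeAbout_of_mem_saddlePoints hf hg hf_concave hg_convex hw) hfield.norm
      (fun z _ => norm_primalDualField_le z) (continuous_relativeGap hf.continuous hg.continuous))

theorem tendsto_fst (hf_concave : StrictConcaveOn ℝ univ f) :
    Tendsto (fun t => (γ t).fst) atTop (𝓝 w.fst) := by
  have hdiss := isDissipativeAbout_of_mem_saddlePoints hf hg hf_concave.concaveOn hg_convex hw
  have hlagrangian : Tendsto (fun t => lagrangian f g w.fst w.snd - lagrangian f g (γ t).fst w.snd)
      atTop (𝓝 0) := by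
    refine squeeze_zero' (.of_forall fun t => sub_nonneg.2 (hw.2.1 _)) ?_
      (tendsto_relativeGap_zero hf hg hg_convex hfield hw hγ hf_concave.concaveOn)
    filter_upwards [eventually_ge_atTop 0] with t ht
    exact sub_lagrangian_le_relativeGap hw (hγ.mem t ht (EReal.coe_lt_top t))
  refine tendsto_of_tendsto_comp
    ((isCompact_closedBall w ‖γ 0 - w‖).image (f := fun z : State n m => z.fst) (by fun_prop)) ?_
    (ψ := fun x => lagrangian f g w.fst w.snd - lagrangian f g x w.snd) ?_ hlagrangian
    fun x _ hx => ?_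
  · filter_upwards [eventually_ge_atTop 0] with t ht
    exact mem_image_of_mem _ (hγ.mem_closedBall hdiss ht)
  · have := hf.continuous
    have := hg.continuous
    unfold lagrangian
    fun_prop
  · rw [sub_eq_zero] at hx
    exact (strictConcaveOn_lagrangian hf_concave hg_convex hw.1).eq_of_isMaxOn
      (fun y _ => (hw.2.1 y).trans hx.le) (fun y _ => hw.2.1 y) (mem_univ x) (mem_univ w.fst)

theorem tendsto_saddleField_fst_zero (hf_concave : StrictConcaveOn ℝ univ f) :
    Tendsto (fun t => (saddleField f g (γ t)).fst) atTop (𝓝 0) := by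
  let primalPart : State n m →L[ℝ] EuclideanSpace ℝ (Fin n) := (ContinuousLinearMap.fst ℝ _ _).comp
    (WithLp.prodContinuousLinearEquiv 2 ℝ _ (EuclideanSpace ℝ (Fin m))).toContinuousLinearMap
  have hdiss := isDissipativeAbout_of_mem_saddlePoints hf hg hf_concave.concaveOn hg_convex hw
  exact hγ.tendsto_map_velocity_zero primalPart
    (hγ.uniformContinuousOn_comp hdiss hfield.norm (fun z _ => norm_primalDualField_le z)
      (primalPart.continuous.comp hfield))
    (tendsto_fst hf hg hg_convex hfield hw hγ hf_concave)

theorem mem_saddlePoints_of_mapClusterPt (hf_concave : StrictConcaveOn ℝ univ f)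
    (hz : MapClusterPt z atTop γ) : z ∈ saddlePoints f g := by
  have hzdom : z ∈ domain n m := by
    rw [← orthant_multiplierAxis]
    refine (isClosed_orthant _).mem_of_mapClusterPt hz ?_
    filter_upwards [eventually_ge_atTop 0] with t ht
    exact orthant_multiplierAxis.symm ▸ hγ.mem t ht (EReal.coe_lt_top t)
  have hzfst : z.fst = w.fst := eq_of_mapClusterPt_of_tendsto_comp hz
    (ψ := fun z : State n m => z.fst) (by fun_prop)
    (tendsto_fst hf hg hg_convex hfield hw hγ hf_concave)
  have hzgap : relativeGap f g w z = 0 := eq_of_mapClusterPt_of_tendsto_comp hz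
    (continuous_relativeGap hf.continuous hg.continuous).continuousAt
    (tendsto_relativeGap_zero hf hg hg_convex hfield hw hγ hf_concave.concaveOn)
  have hzvelocity : (saddleField f g z).fst = 0 := eq_of_mapClusterPt_of_tendsto_comp hz
    (ψ := fun z => (saddleField f g z).fst) (by fun_prop)
    (tendsto_saddleField_fst_zero hf hg hg_convex hfield hw hγ hf_concave)
  refine mem_saddlePoints_of_relativeGap_eq_zero hw hzdom hzfst hzgap fun x => ?_
  simpa only [hzvelocity, inner_zero_left, add_zero] using
    lagrangian_le_add_inner hf hg hf_concave.concaveOn hg_convex hzdom x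

theorem exists_tendsto_saddlePoint (hf_concave : StrictConcaveOn ℝ univ f) :
    ∃ z ∈ saddlePoints f g, Tendsto γ atTop (𝓝 z) := by
  have hdiss := fun {v} => isDissipativeAbout_of_mem_saddlePoints (w := v) hf hg
    hf_concave.concaveOn hg_convex
  obtain ⟨z, -, hz⟩ := (isCompact_closedBall w ‖γ 0 - w‖).exists_mapClusterPt (f := atTop) (u := γ)
    (tendsto_principal.2 <| (eventually_ge_atTop 0).mono fun t => hγ.mem_closedBall (hdiss hw))
  have hzS := mem_saddlePoints_of_mapClusterPt hf hg hg_convex hfield hw hγ hf_concave hz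
  exact ⟨z, hzS, hγ.tendsto_of_mapClusterPt (hdiss hzS) hz⟩

end Solutions

end Convergence

end PrimalDual

theorem mainTheorem1 (n m : ℕ)
    (f : EuclideanSpace ℝ (Fin n) → ℝ)
    (g : EuclideanSpace ℝ (Fin n) → EuclideanSpace ℝ (Fin m))
    (hf : ContDiff ℝ 1 f) (hg : ContDiff ℝ 1 g)
    (hf_concave : StrictConcaveOn ℝ Set.univ f)
    (hg_convex : ∀ i, ConvexOn ℝ Set.univ (fun x => g x i))
    (hf_lip : LocallyLipschitz (gradient f))
    (hg_lip : ∀ i, LocallyLipschitz (gradient (fun x => g x i)))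
    (h_slater : ∃ x, ∀ i, g x i < 0)
    (h_opt : ∃ x, PrimalDual.IsPrimalOptimizer f g x) :
    PrimalDual.primalDualOptimizers f g = PrimalDual.saddlePoints f g ∧
    PrimalDual.IsGloballyAsymptoticallyStableOn (PrimalDual.domain n m)
      (PrimalDual.primalDualField f g) (PrimalDual.primalDualOptimizers f g) ∧
    ∀ γ : ℝ → PrimalDual.State n m,
      PrimalDual.IsCaratheodorySolution (PrimalDual.domain n m)
        (PrimalDual.primalDualField f g) ⊤ γ →
      ∃ z ∈ PrimalDual.primalDualOptimizers f g, Filter.Tendsto γ Filter.atTop (nhds z) := by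
  open PrimalDual in
  have hconcave := hf_concave.concaveOn
  have hf' := hf.differentiable one_ne_zero
  have hg' := hg.differentiable one_ne_zero
  have hfield := locallyLipschitz_saddleField hg.locallyLipschitz hf_lip hg_lip
  obtain ⟨w, hw⟩ := saddlePoints_nonempty hconcave hg_convex h_slater h_opt
  have hdiss {v} := isDissipativeAbout_of_mem_saddlePoints (w := v) hf' hg' hconcave hg_convex
  have hconv {γ} (hγ : IsCaratheodorySolution (domain n m) (primalDualField f g) ⊤ γ) :=
    exists_tendsto_saddlePoint hf' hg' hg_convex hfield.continuous hw hγ hf_concave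
  rw [primalDualOptimizers_eq_saddlePoints hconcave hg_convex h_slater]
  refine ⟨rfl, isGloballyAsymptoticallyStableOn_of_isDissipativeAbout (fun _ hz => hz.1)
    (fun _ => hdiss) ?_ (fun z hz => ?_) fun _ => hconv, fun _ => hconv⟩
  all_goals
    rw [← projectVelocity_multiplierAxis_saddleField, ← orthant_multiplierAxis] at *
  · exact fun B => exists_isOneSidedLipschitzOn_projectVelocity hfield
  · exact exists_isCaratheodorySolution_of_locallyLipschitz orthonormal_multiplierAxis hfield
      (hdiss hw) hz
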